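/- Let $k$ be a field and $Q$ a finite quiver (oriented cycles allowed). Let $\operatorname{Mod}(Q)$ be the category of finitely generated representations of $Q$ over $k$ (i.e. finitely generated left $kQ$-modules), $\operatorname{Hom}_Q$ and $\operatorname{Ext}_Q=\operatorname{Ext}^1_Q$ the groups in the abelian category of all representations, and write $M\perp N$ if $\operatorname{Hom}_Q(M,N)=0=\operatorname{Ext}_Q(M,N)$. For a vertex $v$ let $P_v=kQe_v$, let $I_v=(e_vkQ)^*$ (the $k$-linear dual), and let $S_v$ be the representation that is $k$ at $v$, zero at all other vertices, with all arrows acting by $0$. A representation $E\in\operatorname{Mod}(Q)$ is exceptional if $\operatorname{Hom}_Q(E,E)=k\cdot\mathrm{id}$ is one-dimensional and $\operatorname{Ext}_Q(E,E)=0$; it is Hom-finite if $\operatorname{Hom}_Q(E,X)$, $\operatorname{Ext}_Q(E,X)$, $\operatorname{Hom}_Q(X,E)$, $\operatorname{Ext}_Q(X,E)$ are finite-dimensional for all $X\in\operatorname{Mod}(Q)$. For $E$ exceptional and Hom-finite let $\tilde\pi_E:\operatorname{Mod}(Q)\to E^\perp=\{N\in\operatorname{Mod}(Q): E\perp N\}$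 be the left adjoint of the inclusion; it is called exact if it sends short exact sequences to short exact sequences. Let $\tau M=\operatorname{Ext}_Q(M,kQ)^*$ be the Auslander--Reiten translate and $\nu M=\operatorname{Hom}_Q(M,kQ)^*$ the Nakayama functor. The dual projection $\tilde\pi_E^\vee$ is the left orthogonal projection through $F$, where $F=\tau E$ if $E$ is not projective and $F=\nu E$ if $E$ is projective: that is, $\tilde\pi_E^\vee(M)\to M$ is the universal morphism to $M$ from a representation $X$ with $X\perp F$. Write $\tilde\pi_i,\tilde\pi_i^\vee$ for $E=S_i$. Then the following hold. 1. For all vertices $i,k$, $\operatorname{Ext}_Q(S_i,S_k)$ is finite-dimensional, and its dimension $a_{ik}$ is the number of arrows from $i$ to $k$. 2. Let $S_i$ be exceptional. If $S_i$ is not projective, then $\tilde\pi_i^\vee(I_j)$ exists for every vertex $j$, and $$\tilde\pi_i^\vee(I_j)\cong\begin{cases}\bigoplus_{k\in Q_V}a_{ik}I_k & \text{if } j=i,\\ I_j&\text{if } j\ne i.\end{cases}$$ If $S_i$ is projective, then $\tilde\pi_i^\vee(I_j)$ exists for every $j$, $\tilde\pi_i^\vee(I_i)=0$, and $\tilde\pi_i^\vee(I_j)\cong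 I_j$ for $j\neq i$. 3. If $S_i$ is exceptional and Hom-finite, then $\tilde\pi_i$ is exact. 4. If $E$ is exceptional and Hom-finite, then $\tilde\pi_E$ exists, and it is exact if and only if $E\cong S_i$ for some vertex $i$. -/

import Mathlib

open CategoryTheory CategoryTheory.Limits
open scoped ZeroObject

universe u

namespace QuiverProj

noncomputable section

/-- Representations of the quiver `V` over `k` (when `V` has finitely many vertices these are the
left modules over the path algebra `kV`): functors from the path category to `k`-modules.
A path from `v` to `w` acts as a linear map `M.obj v → M.obj w`. -/
abbrev QRep (k : Type u) [Field k] (V : Type u) [Quiver.{u} V] : Type (u + 1) :=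
  Paths V ⥤ ModuleCat.{u} k

variable {k : Type u} [Field k] {V : Type u} [Quiver.{u} V]

/-! Representations form a Grothendieck abelian category; in particular `Abelian.Ext` is available
with values in `Type u`. -/

instance : HasSeparator (QRep k V) :=
  HasSeparator.of_equivalence ((opOpEquivalence (Paths V)).congrLeft (E := ModuleCat.{u} k))

instance : AB5OfSize.{u, u} (QRep k V) where
  ofShape J _ _ := by infer_instance

instance : IsGrothendieckAbelian.{u} (QRep k V) where

instance : HasFiniteBiproducts (QRep k V) := Abelian.hasFiniteBiproducts

/-- `Ext¹` in the abelian category of representations; it is a `k`-vector space. -/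
abbrev Ext1 (M N : QRep k V) : Type u := Abelian.Ext M N 1

/-- Finitely generated representations: there are finitely many elements `m j ∈ M_(v j)` such that
every `M_w` is spanned by the images of the `m j` under the paths from `v j` to `w`. -/
def IsFG : ObjectProperty (QRep k V) := fun M =>
  ∃ (n : ℕ) (v : Fin n → Paths V) (m : ∀ j, M.obj (v j)), ∀ w : Paths V,
    Submodule.span k {x : M.obj w | ∃ (j : Fin n) (p : v j ⟶ w), x = M.map p (m j)} = ⊤

/-- The category `Mod(Q)` of finitely generated representations. -/
abbrev FGRep (k : Type u) [Field k] (V : Type u) [Quiver.{u} V] : Type (u + 1) :=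
  (IsFG (k := k) (V := V)).FullSubcategory

/-- `M ⊥ N`: `Hom(M, N) = 0` and `Ext¹(M, N) = 0`. -/
def Orth (M N : QRep k V) : Prop :=
  Subsingleton (M ⟶ N) ∧ Subsingleton (Ext1 M N)

/-- `E` is exceptional: it is finitely generated, `Hom(E, E)` is one-dimensional (hence spanned by
the identity) and `Ext¹(E, E) = 0`. -/
structure IsExceptional (E : QRep k V) : Prop where
  fg : IsFG E
  finrank_end : Module.finrank k (E ⟶ E) = 1
  ext_self : Subsingleton (Ext1 E E)

/-- `E` is right and left Hom-finite. -/
structure IsHomFinite (E : QRep k V) : Prop where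
  hom_right : ∀ X : QRep k V, IsFG X → Module.Finite k (E ⟶ X)
  ext_right : ∀ X : QRep k V, IsFG X → Module.Finite k (Ext1 E X)
  hom_left : ∀ X : QRep k V, IsFG X → Module.Finite k (X ⟶ E)
  ext_left : ∀ X : QRep k V, IsFG X → Module.Finite k (Ext1 X E)

/-! ### The right orthogonal projection -/

/-- The objects of `E^⊥ ⊆ Mod(Q)`. -/
def rightOrth (E : QRep k V) : ObjectProperty (QRep k V) := fun N => IsFG N ∧ Orth E N

theorem rightOrth_le (E : QRep k V) : rightOrth E ≤ IsFG := fun _ h => h.1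

/-- The inclusion `E^⊥ ⥤ Mod(Q)`. The right orthogonal projection through `E` is its left
adjoint. -/
abbrev rightOrthIncl (E : QRep k V) : (rightOrth E).FullSubcategory ⥤ FGRep k V :=
  ObjectProperty.ιOfLE (rightOrth_le E)

/-- A functor `Mod(Q) ⥤ E^⊥` is exact: it maps short exact sequences of finitely generated
representations to short exact sequences. -/
def IsExactFunctor {E : QRep k V} (F : FGRep k V ⥤ (rightOrth E).FullSubcategory) : Prop :=
  ∀ (X Y Z : FGRep k V) (f : X ⟶ Y) (g : Y ⟶ Z) (w : f.hom ≫ g.hom = 0),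
    (ShortComplex.mk f.hom g.hom w).ShortExact →
      ∃ w' : (F.map f).hom ≫ (F.map g).hom = 0,
        (ShortComplex.mk (F.map f).hom (F.map g).hom w').ShortExact

/-! ### Standard representations -/

/-- The simple representation `S_i`: `k` at the vertex `i`, zero elsewhere, all arrows zero. -/
def simpleRep (k : Type u) [Field k] {V : Type u} [Quiver.{u} V] (i : V) : QRep k V :=
  Paths.lift
    { obj := fun v => ModuleCat.of k (PLift (v = i) → k)
      map := fun _ => 0 }

/-- The projectives `P_v`, contravariantly in the vertex: `(P_v)_w` has the paths from `v` to `w` as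
a basis and paths act by concatenation. -/
def projRep (k : Type u) [Field k] (V : Type u) [Quiver.{u} V] : (Paths V)ᵒᵖ ⥤ QRep k V :=
  coyoneda ⋙ (Functor.whiskeringRight _ _ _).obj (ModuleCat.free k)

/-- The injective `I_j`: `(I_j)_w` is the dual of the space with basis the paths from `w` to `j`. -/
def injRep (k : Type u) [Field k] {V : Type u} [Quiver.{u} V] (j : V) : QRep k V where
  obj w := ModuleCat.of k ((w ⟶ (Paths.of V).obj j) → k)
  map p := ModuleCat.ofHom (LinearMap.funLeft k k (fun q => p ≫ q))
  map_id w := by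
    ext f q
    simp [LinearMap.funLeft]
  map_comp p q := by
    ext f r
    simp [LinearMap.funLeft]

/-- The number `a_{ij}` of arrows from `i` to `j`. -/
def arrowCount (i j : V) : ℕ := Nat.card (i ⟶ j)

/-! ### Auslander-Reiten translate, Nakayama functor, dual right orthogonal projection -/

/-- The Nakayama functor `ν M = D Hom(M, kQ)`, i.e. `(ν M)_v = Hom(M, P_v)^*`. -/
def nakayama (M : QRep k V) : QRep k V where
  obj v := ModuleCat.of k (Module.Dual k (M ⟶ (projRep k V).obj (Opposite.op v)))
  map p := ModuleCat.ofHom (Linear.rightComp k M ((projRep k V).map p.op)).dualMap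
  map_id v := by
    ext φ x
    simp [LinearMap.dualMap_apply]
  map_comp p q := by
    ext φ x
    simp [LinearMap.dualMap_apply]

/-- The Auslander-Reiten translate over the hereditary algebra `kQ`: `τ M = D Ext¹(M, kQ)`,
i.e. `(τ M)_v = Ext¹(M, P_v)^*`. -/
def tau (M : QRep k V) : QRep k V where
  obj v := ModuleCat.of k (Module.Dual k (Ext1 M ((projRep k V).obj (Opposite.op v))))
  map p := ModuleCat.ofHom
    (((Abelian.Ext.mk₀ ((projRep k V).map p.op)).postcompOfLinear k M (add_zero 1)).dualMap)
  map_id v := by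
    ext φ x
    simp [LinearMap.dualMap_apply]
  map_comp p q := by
    ext φ x
    simp [LinearMap.dualMap_apply, ← Abelian.Ext.mk₀_comp_mk₀]

/-- `c : N ⟶ M` exhibits `N` as the left orthogonal projection of `M` through `F`: it is the
universal morphism to `M` from an object of the left orthogonal category `^⊥F`, that is, `N` with
`c` is the value at `M` of the right adjoint of the inclusion of `^⊥F`. -/
structure IsLeftOrthProj (F M N : QRep k V) (c : N ⟶ M) : Prop where
  mem : Orth N F
  existsUnique : ∀ (X : QRep k V), Orth X F → ∀ f : X ⟶ M, ∃! g : X ⟶ N, g ≫ c = f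

open Classical in
/-- The object through which the dual right orthogonal projection is taken: `ν E` if `E` is
projective and `τ E` otherwise. -/
def dualObject (E : QRep k V) : QRep k V :=
  if Projective E then nakayama E else tau E

/-- `N` is (isomorphic to) the value at `M` of the dual right orthogonal projection `π̃_E^∨`, the
left orthogonal projection through `τ E` (through `ν E` if `E` is projective). -/
def IsDualProj (E M N : QRep k V) : Prop :=
  ∃ c : N ⟶ M, IsLeftOrthProj (dualObject E) M N c

end

end QuiverProj

namespace QuiverProj

noncomputable section

variable {k : Type u} [Field k] {V : Type u} [Quiver.{u} V]

/-! ### Morphisms and exact sequences of representations, pointwise -/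

/-! A nontrivial path starting at i is uniquely an arrow i → w followed by a path. This gives the
projective resolution 0 → ⨁ P_w → P_i → S_i → 0 over the arrows i → w (`starRep_shortExact`). Hence
Hom(S_i, M) and Ext¹(S_i, M) are the kernel and cokernel of the joint action `starAct` : M_i → ∏
M_w. For M = S_j this counts arrows, and S_i ⊥ M forces `starAct` to be bijective.

Dualising, if some arrow leaves i there is an exact sequence 0 → τS_i → ∏ I_w → I_i → 0
(`tau_shortExact`), so X ⊥ τS_i means that every map X → I_i lifts uniquely to ∏ I_w
(`orth_tau_iff`). Since Hom(X, I_j) is the dual of X_j, this holds as soon as `starAct` is bijective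
on X, which covers I_j for j ≠ i and, without loops at i, the product itself. If S_i is projective,
no arrow leaves i, νS_i is I_i, and X ⊥ νS_i just means Hom(X, I_i) = 0.

For exceptional Hom-finite E the reflection of M is built by successive extensions by E until
Ext¹(E, -) vanishes, then by dividing out images of E until Hom(E, -) vanishes. Heredity
(`ext1_postcomp_surjective`) keeps Ext¹ zero in the second stage. Each step is invisible to objects
of E^⊥ and bijective at vertices where E is zero (`IsReflStep`).

For E ≅ S_i the unit is therefore bijective away from i, and the fibre at i of an object of S_i^⊥ is
a product of fibres at other vertices, so exactness can be checked pointwise. Conversely, an exact π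
kills E and hence all its finitely generated subobjects, while a nonzero proper one would embed into
an object of E^⊥ (`IsExceptional.isIso_of_mono`). A count with the Euler form produces a vector of E
killed by all arrows (`IsExceptional.exists_killed`), so some S_v embeds into E and is all of it. -/

theorem comp_app_apply {L M N : QRep k V} (f : L ⟶ M) (g : M ⟶ N) (v : Paths V) (x : L.obj v) :
    (f ≫ g).app v x = g.app v (f.app v x) := rfl

theorem map_comp_apply (M : QRep k V) {u v w : Paths V} (p : u ⟶ v) (q : v ⟶ w) (x : M.obj u) :
    M.map (p ≫ q) x = M.map q (M.map p x) := by
  rw [M.map_comp]; rfl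

theorem map_id_apply (M : QRep k V) (v : Paths V) (x : M.obj v) : M.map (𝟙 v) x = x := by
  rw [M.map_id]; rfl

theorem hom_ext_apply {M N : QRep k V} {f g : M ⟶ N}
    (h : ∀ (v : V) (x : M.obj ((Paths.of V).obj v)), f.app _ x = g.app _ x) : f = g := by
  ext v x
  exact h v x

/-- The space of a representation at a vertex. -/
abbrev fib (M : QRep k V) (v : V) : Type u := M.obj ((Paths.of V).obj v)

/-- The action of an arrow on a representation. -/
abbrev act (M : QRep k V) {v w : V} (a : v ⟶ w) : fib M v →ₗ[k] fib M w :=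
  (M.map ((Paths.of V).map a)).hom

/-- The component of a morphism of representations at a vertex. -/
abbrev comp {M N : QRep k V} (f : M ⟶ N) (v : V) : fib M v →ₗ[k] fib N v :=
  (f.app ((Paths.of V).obj v)).hom

theorem comp_act {M N : QRep k V} (f : M ⟶ N) {v w : V} (a : v ⟶ w) (x : fib M v) :
    comp f w (act M a x) = act N a (comp f v x) :=
  NatTrans.naturality_apply f ((Paths.of V).map a) x

/-- A morphism of representations is a family of linear maps commuting with the arrows. -/
def homMk {M N : QRep k V} (φ : ∀ v : V, fib M v →ₗ[k] fib N v)
    (h : ∀ (v w : V) (a : v ⟶ w) (x : fib M v), φ w (act M a x) = act N a (φ v x)) : M ⟶ N where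
  app v := ModuleCat.ofHom (φ v)
  naturality v w p := by
    induction p using Paths.induction with
    | id => simp
    | comp p q ih =>
      rw [M.map_comp, N.map_comp, Category.assoc]
      have : M.map ((Paths.of V).map q) ≫ ModuleCat.ofHom (φ _) =
          ModuleCat.ofHom (φ _) ≫ N.map ((Paths.of V).map q) := by
        ext x
        exact h _ _ q x
      erw [this]
      rw [← Category.assoc]
      exact (congrArg (· ≫ N.map ((Paths.of V).map q)) ih).trans (Category.assoc _ _ _)

/-- The representation with given spaces at the vertices and given actions of the arrows. -/
def ofArrows (W : V → Type u) [∀ v, AddCommGroup (W v)] [∀ v, Module k (W v)]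
    (A : ∀ v w : V, (v ⟶ w) → (W v →ₗ[k] W w)) : QRep k V :=
  Paths.lift
    { obj := fun v => ModuleCat.of k (W v)
      map := fun {v w} a => ModuleCat.ofHom (A v w a) }

theorem act_ofArrows (W : V → Type u) [∀ v, AddCommGroup (W v)] [∀ v, Module k (W v)]
    (A : ∀ v w : V, (v ⟶ w) → (W v →ₗ[k] W w)) {v w : V} (a : v ⟶ w) :
    act (ofArrows W A) a = A v w a :=
  congrArg ModuleCat.Hom.hom (Paths.lift_toPath _ a)

theorem mono_iff_app {M N : QRep k V} (f : M ⟶ N) :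
    Mono f ↔ ∀ v : Paths V, Function.Injective (f.app v) := by
  rw [NatTrans.mono_iff_mono_app]
  simp only [ModuleCat.mono_iff_injective]

theorem epi_iff_app {M N : QRep k V} (f : M ⟶ N) :
    Epi f ↔ ∀ v : Paths V, Function.Surjective (f.app v) := by
  rw [NatTrans.epi_iff_epi_app]
  simp only [ModuleCat.epi_iff_surjective]

theorem shortExact_mk {L M N : QRep k V} {f : L ⟶ M} {g : M ⟶ N} (w : f ≫ g = 0)
    (hf : ∀ v : Paths V, Function.Injective (f.app v))
    (hg : ∀ v : Paths V, Function.Surjective (g.app v))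
    (h : ∀ (v : Paths V) (x : M.obj v), g.app v x = 0 → ∃ y, f.app v y = x) :
    (ShortComplex.mk f g w).ShortExact where
  mono_f := (mono_iff_app f).2 hf
  epi_g := (epi_iff_app g).2 hg
  exact := by
    rw [ShortComplex.exact_iff_kernel_ι_comp_cokernel_π_zero]
    refine hom_ext_apply fun v x => ?_
    have h1 : g.app _ ((kernel.ι g).app _ x) = 0 := by
      rw [← comp_app_apply, kernel.condition]; rfl
    obtain ⟨y, hy⟩ := h _ _ h1
    dsimp only
    rw [comp_app_apply, ← hy, ← comp_app_apply, cokernel.condition]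
    rfl

theorem exact_app {S : ShortComplex (QRep k V)} (hS : S.Exact) (v : Paths V) (x : S.X₂.obj v)
    (hx : S.g.app v x = 0) : ∃ y, S.f.app v y = x :=
  (ShortComplex.moduleCat_exact_iff _).1
    (hS.map ((evaluation (Paths V) (ModuleCat.{u} k)).obj v)) x hx

theorem shortExact_app {S : ShortComplex (QRep k V)} (hS : S.ShortExact) (v : Paths V) :
    Function.Injective (S.f.app v) ∧ Function.Surjective (S.g.app v) ∧
      ∀ x : S.X₂.obj v, S.g.app v x = 0 → ∃ y, S.f.app v y = x := by
  have h := hS.map_of_exact ((evaluation (Paths V) (ModuleCat.{u} k)).obj v)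
  exact ⟨h.moduleCat_injective_f, h.moduleCat_surjective_g,
    fun x hx => (ShortComplex.moduleCat_exact_iff _).1 h.exact x hx⟩

theorem shortExact_cokernel {L M : QRep k V} (f : L ⟶ M) [Mono f] :
    (ShortComplex.mk f (cokernel.π f) (cokernel.condition f)).ShortExact where
  exact := ShortComplex.exact_cokernel f

theorem shortExact_kernel {L M : QRep k V} (f : L ⟶ M) [Epi f] :
    (ShortComplex.mk (kernel.ι f) f (kernel.condition f)).ShortExact where
  exact := ShortComplex.exact_kernel f

/-! ### Extensions -/

/-- Every class in `Ext¹(E, Y)` is the class of a short exact sequence. -/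
theorem exists_extClass_eq {E Y : QRep k V} (x : Ext1 E Y) :
    ∃ (M : QRep k V) (f : Y ⟶ M) (g : M ⟶ E) (w : f ≫ g = 0)
      (h : (ShortComplex.mk f g w).ShortExact), h.extClass = x := by
  -- The class dies in an injective containing `Y`, so it is the connecting image of a map from `E`
  -- to the cokernel; pulling the sequence back along that map realises the class.
  let S := ShortComplex.mk (Injective.ι Y) (cokernel.π (Injective.ι Y)) (cokernel.condition _)
  have hS : S.ShortExact := shortExact_cokernel _
  obtain ⟨y, hy⟩ := Abelian.Ext.covariant_sequence_exact₁ E hS x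
    (Abelian.Ext.eq_zero_of_injective (n := 0) _) (n₀ := 0) rfl
  obtain ⟨t, rfl⟩ := (Abelian.Ext.mk₀_bijective _ _).2 y
  let M := pullback S.g t
  let f : Y ⟶ M := pullback.lift S.f 0 (by simp)
  have w : f ≫ pullback.snd S.g t = 0 := pullback.lift_snd _ _ _
  have hf : f ≫ pullback.fst S.g t = S.f := pullback.lift_fst _ _ _
  have : Epi S.g := hS.epi_g
  have : Mono S.f := hS.mono_f
  have : Mono f := mono_of_mono_fac hf
  have h : (ShortComplex.mk f (pullback.snd S.g t) w).ShortExact := by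
    refine { exact := ShortComplex.exact_of_f_is_kernel _ (KernelFork.IsLimit.ofι' _ _ ?_) }
    intro A a ha
    have ha' : (a ≫ pullback.fst S.g t) ≫ S.g = 0 := by
      rw [Category.assoc, pullback.condition, reassoc_of% ha, zero_comp]
    refine ⟨hS.exact.lift _ ha', ?_⟩
    apply pullback.hom_ext
    · rw [Category.assoc, hf]; exact hS.exact.lift_f _ _
    · rw [Category.assoc, w, ha, comp_zero]
  refine ⟨M, f, pullback.snd S.g t, w, h, ?_⟩
  let φ : ShortComplex.mk f (pullback.snd S.g t) w ⟶ S :=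
    { τ₁ := 𝟙 _, τ₂ := pullback.fst S.g t, τ₃ := t
      comm₁₂ := by simp [hf]
      comm₂₃ := pullback.condition }
  have := ShortComplex.ShortExact.extClass_naturality h hS φ
  rw [← hy]
  simpa [φ] using this

/-- The extension of `E` by `Y` given by a linear map `ψ a : E_v → Y_w` for every arrow
`a : v ⟶ w`. -/
def twist (Y E : QRep k V) (ψ : ∀ v w : V, (v ⟶ w) → (fib E v →ₗ[k] fib Y w)) : QRep k V :=
  ofArrows (fun v => fib Y v × fib E v) fun v w a =>
    LinearMap.prod
      (act Y a ∘ₗ LinearMap.fst k (fib Y v) (fib E v) +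
        ψ v w a ∘ₗ LinearMap.snd k (fib Y v) (fib E v))
      (act E a ∘ₗ LinearMap.snd k (fib Y v) (fib E v))

section Twist

variable (Y E : QRep k V) (ψ : ∀ v w : V, (v ⟶ w) → (fib E v →ₗ[k] fib Y w))

theorem act_twist {v w : V} (a : v ⟶ w) (x : fib Y v × fib E v) :
    act (twist Y E ψ) a x = ((act Y a x.1 + ψ v w a x.2, act E a x.2) : fib Y w × fib E w) := by
  unfold twist
  rw [act_ofArrows]
  rfl

/-- The inclusion of the subrepresentation of a twisted extension. -/
def twistInl : Y ⟶ twist Y E ψ :=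
  homMk (N := twist Y E ψ) (fun v => LinearMap.inl k (fib Y v) (fib E v)) fun v w a x => by
    refine Eq.trans ?_ (act_twist Y E ψ a _).symm
    change (act Y a x, (0 : fib E w)) = (act Y a x + ψ v w a 0, act E a 0)
    rw [map_zero, map_zero, add_zero]

/-- The projection of a twisted extension onto the quotient. -/
def twistSnd : twist Y E ψ ⟶ E :=
  homMk (M := twist Y E ψ) (fun v => LinearMap.snd k (fib Y v) (fib E v)) fun _ _ a x =>
    congrArg Prod.snd (act_twist Y E ψ a x)

theorem twistInl_comp_twistSnd : twistInl Y E ψ ≫ twistSnd Y E ψ = 0 :=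
  hom_ext_apply fun _ _ => rfl

theorem twist_shortExact :
    (ShortComplex.mk _ _ (twistInl_comp_twistSnd Y E ψ)).ShortExact := by
  refine shortExact_mk _ (fun v x y h => congrArg Prod.fst h) (fun v x => ⟨(0, x), rfl⟩) ?_
  intro v x hx
  exact ⟨x.1, Prod.ext rfl (Eq.symm hx)⟩

end Twist

/-- If `Ext¹(E, Y) = 0`, then every family of linear maps indexed by the arrows is a coboundary. -/
theorem exists_coboundary {E Y : QRep k V} [Subsingleton (Ext1 E Y)]
    (ψ : ∀ v w : V, (v ⟶ w) → (fib E v →ₗ[k] fib Y w)) :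
    ∃ h : ∀ v : V, fib E v →ₗ[k] fib Y v, ∀ (v w : V) (a : v ⟶ w) (e : fib E v),
      ψ v w a e = h w (act E a e) - act Y a (h v e) := by
  -- Since Ext¹(E, Y) = 0, the identity of `E` lifts to a section of the twisted extension; the
  -- `Y`-component of that section is the required family.
  obtain ⟨t, ht⟩ := Abelian.Ext.covariant_sequence_exact₃ E (twist_shortExact Y E ψ)
    (Abelian.Ext.mk₀ (𝟙 E)) (n₁ := 1) rfl (Subsingleton.elim _ _)
  obtain ⟨s, rfl⟩ := (Abelian.Ext.mk₀_bijective _ _).2 t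
  rw [Abelian.Ext.mk₀_comp_mk₀] at ht
  have hs := (Abelian.Ext.mk₀_bijective _ _).1 ht
  let s' : ∀ v : V, fib E v →ₗ[k] fib Y v × fib E v := fun v => comp s v
  refine ⟨fun v => LinearMap.fst k (fib Y v) (fib E v) ∘ₗ s' v, fun v w a e => ?_⟩
  have h2 : ∀ (v : V) (e : fib E v), (s' v e).2 = e :=
    fun v e => congrArg (fun f : E ⟶ E => comp f v e) hs
  have h1 := congrArg Prod.fst ((comp_act s a e).trans (act_twist Y E ψ a (s' v e)))
  dsimp only at h1
  rw [h2] at h1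
  rw [eq_sub_iff_add_eq']
  exact h1.symm

/-- The category of representations is hereditary: `Ext¹(E, -)` preserves epimorphisms. -/
theorem ext1_postcomp_surjective (E : QRep k V) {Y Z : QRep k V} (g : Y ⟶ Z) [Epi g] :
    Function.Surjective
      fun x : Ext1 E Y => x.comp (Abelian.Ext.mk₀ g) (add_zero 1) := by
  intro z
  obtain ⟨M, i, q, w, hS, rfl⟩ := exists_extClass_eq z
  have hq : ∀ v : V, Function.Surjective (comp q v) := fun v => (shortExact_app hS v).2.1
  have hi : ∀ v : V, Function.Injective (comp i v) := fun v => (shortExact_app hS v).1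
  have hex : ∀ (v : V) (x : fib M v), comp q v x = 0 → ∃ y, comp i v y = x :=
    fun v => (shortExact_app hS v).2.2
  have hg : ∀ v : V, Function.Surjective (comp g v) := fun v =>
    (epi_iff_app g).1 inferInstance v
  choose σ hσ using fun v : V =>
    (comp q v).exists_rightInverse_of_surjective (LinearMap.range_eq_top.2 (hq v))
  have hσ' : ∀ v e, comp q v (σ v e) = e := fun v e => LinearMap.congr_fun (hσ v) e
  choose ρ hρ using fun v : V =>
    (comp i v).exists_leftInverse_of_injective (LinearMap.ker_eq_bot.2 (hi v))
  have hρ' : ∀ v m, comp q v m = 0 → comp i v (ρ v m) = m := by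
    intro v m hm
    obtain ⟨y, rfl⟩ := hex v m hm
    exact congrArg _ (LinearMap.congr_fun (hρ v) y)
  choose τ hτ using fun v : V =>
    (comp g v).exists_rightInverse_of_surjective (LinearMap.range_eq_top.2 (hg v))
  have hτ' : ∀ v e, comp g v (τ v e) = e := fun v e => LinearMap.congr_fun (hτ v) e
  -- The cocycle of `M` relative to the linear splitting `σ`, lifted along `g` one arrow at a time.
  -- No relation between arrows constrains the lift, which is why the category is hereditary.
  let ψ : ∀ v w : V, (v ⟶ w) → (fib E v →ₗ[k] fib Y w) :=
    fun v w a => τ w ∘ₗ ρ w ∘ₗ (act M a ∘ₗ σ v - σ w ∘ₗ act E a)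
  have hψ : ∀ v w (a : v ⟶ w) (e : fib E v),
      comp i w (comp g w (ψ v w a e)) = act M a (σ v e) - σ w (act E a e) := by
    intro v w a e
    refine (congrArg _ (hτ' _ _)).trans (hρ' _ _ ?_)
    rw [LinearMap.sub_apply, map_sub, LinearMap.comp_apply, LinearMap.comp_apply, hσ', comp_act,
      hσ', sub_self]
  let m : twist Y E ψ ⟶ M := homMk (M := twist Y E ψ)
    (fun v => LinearMap.coprod (comp i v ∘ₗ comp g v) (σ v)) (by
      intro v w a x
      refine (congrArg _ (act_twist Y E ψ a x)).trans ?_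
      have key : ∀ (y : fib Y v) (e : fib E v),
          comp i w (comp g w (act Y a y + ψ v w a e)) + σ w (act E a e) =
            act M a (comp i v (comp g v y) + σ v e) := fun y e => by
        rw [map_add, map_add, map_add, hψ, comp_act, comp_act]
        abel
      exact key x.1 x.2)
  let φ : ShortComplex.mk _ _ (twistInl_comp_twistSnd Y E ψ) ⟶ ShortComplex.mk i q w :=
    { τ₁ := g, τ₂ := m, τ₃ := 𝟙 E
      comm₁₂ := hom_ext_apply fun v y => by
        change comp i v (comp g v y) = comp i v (comp g v y) + σ v 0
        rw [map_zero, add_zero]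
      comm₂₃ := hom_ext_apply fun v x => by
        obtain ⟨y, e⟩ := (show fib Y v × fib E v from x)
        change comp q v (comp i v (comp g v y) + σ v e) = e
        rw [map_add, hσ']
        refine (congrArg (· + e) ?_).trans (zero_add _)
        exact congrArg (fun f : Z ⟶ E => comp f v (comp g v y)) w }
  refine ⟨(twist_shortExact Y E ψ).extClass, ?_⟩
  have := ShortComplex.ShortExact.extClass_naturality (twist_shortExact Y E ψ) hS φ
  simpa [φ] using this

theorem subsingleton_ext1_of_epi (E : QRep k V) {Y Z : QRep k V} (g : Y ⟶ Z) [Epi g]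
    [Subsingleton (Ext1 E Y)] : Subsingleton (Ext1 E Z) :=
  (ext1_postcomp_surjective E g).subsingleton

/-! ### Finitely generated representations -/

theorem isFG_of_finite {M : QRep k V} {ι : Type*} [Finite ι] (v : ι → Paths V)
    (m : ∀ j, M.obj (v j))
    (h : ∀ w : Paths V,
      Submodule.span k {x : M.obj w | ∃ (j : ι) (p : v j ⟶ w), x = M.map p (m j)} = ⊤) :
    IsFG M := by
  obtain ⟨n, ⟨e⟩⟩ := Finite.exists_equiv_fin ι
  refine ⟨n, fun j => v (e.symm j), fun j => m (e.symm j), fun w => ?_⟩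
  rw [eq_top_iff, ← h w]
  refine Submodule.span_mono ?_
  rintro x ⟨j, p, rfl⟩
  obtain ⟨i, rfl⟩ := e.symm.surjective j
  exact ⟨i, p, rfl⟩

theorem IsFG.of_epi {M N : QRep k V} (hM : IsFG M) (g : M ⟶ N) [Epi g] : IsFG N := by
  obtain ⟨n, v, m, h⟩ := hM
  refine ⟨n, v, fun j => g.app _ (m j), fun w => ?_⟩
  have hg : Function.Surjective (g.app w) := (epi_iff_app g).1 inferInstance w
  rw [eq_top_iff, ← LinearMap.range_eq_top.2 hg, LinearMap.range_eq_map, ← h w,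
    Submodule.map_span]
  refine Submodule.span_mono ?_
  rintro _ ⟨_, ⟨j, p, rfl⟩, rfl⟩
  exact ⟨j, p, NatTrans.naturality_apply g p (m j)⟩

/-- Generators of the subobject together with lifts of generators of the quotient generate the
middle term. -/
theorem IsFG.of_shortExact {S : ShortComplex (QRep k V)} (hS : S.ShortExact) (h₁ : IsFG S.X₁)
    (h₃ : IsFG S.X₃) : IsFG S.X₂ := by
  obtain ⟨n, v, m, h⟩ := h₁
  obtain ⟨n', v', m', h'⟩ := h₃
  choose l hl using fun j => (shortExact_app hS (v' j)).2.1 (m' j)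
  let m₂ : ∀ j : Fin n ⊕ Fin n', S.X₂.obj (Sum.elim v v' j) := fun j =>
    Sum.rec (motive := fun j => S.X₂.obj (Sum.elim v v' j)) (fun j => S.f.app _ (m j)) l j
  refine isFG_of_finite (ι := Fin n ⊕ Fin n') (Sum.elim v v') m₂ fun w => ?_
  rw [eq_top_iff]
  intro x _
  set T := Submodule.span k {x : S.X₂.obj w | ∃ (j : Fin n ⊕ Fin n') (p : Sum.elim v v' j ⟶ w),
    x = S.X₂.map p (m₂ j)}
  have hf : ∀ y, S.f.app w y ∈ T := by
    intro y
    have hy : y ∈ Submodule.span k {x : S.X₁.obj w | ∃ (j : Fin n) (p : v j ⟶ w),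
      x = S.X₁.map p (m j)} := by rw [h]; trivial
    refine Submodule.span_induction (p := fun y _ => S.f.app w y ∈ T) ?_ ?_ ?_ ?_ hy
    · rintro _ ⟨j, p, rfl⟩
      exact Submodule.subset_span ⟨Sum.inl j, p, NatTrans.naturality_apply S.f p (m j)⟩
    · exact (map_zero (S.f.app w).hom).symm ▸ T.zero_mem
    · intro a b _ _ ha hb
      exact (map_add (S.f.app w).hom a b).symm ▸ T.add_mem ha hb
    · intro c a _ ha
      exact (map_smul (S.f.app w).hom c a).symm ▸ T.smul_mem c ha
  have hg : ∀ z, ∃ t ∈ T, S.g.app w t = z := by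
    intro z
    have hz : z ∈ Submodule.span k {x : S.X₃.obj w | ∃ (j : Fin n') (p : v' j ⟶ w),
      x = S.X₃.map p (m' j)} := by rw [h']; trivial
    refine Submodule.span_induction (p := fun z _ => ∃ t ∈ T, S.g.app w t = z) ?_ ?_ ?_ ?_ hz
    · rintro _ ⟨j, p, rfl⟩
      refine ⟨S.X₂.map p (l j), Submodule.subset_span ⟨Sum.inr j, p, rfl⟩, ?_⟩
      rw [NatTrans.naturality_apply, hl]
    · exact ⟨0, T.zero_mem, map_zero (S.g.app w).hom⟩
    · rintro _ _ _ _ ⟨a, ha, rfl⟩ ⟨b, hb, rfl⟩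
      exact ⟨a + b, T.add_mem ha hb, map_add (S.g.app w).hom a b⟩
    · rintro c _ _ ⟨a, ha, rfl⟩
      exact ⟨c • a, T.smul_mem c ha, map_smul (S.g.app w).hom c a⟩
  obtain ⟨t, ht, htx⟩ := hg (S.g.app w x)
  obtain ⟨y, hy⟩ := (shortExact_app hS w).2.2 (x - t) (by
    refine (map_sub (S.g.app w).hom x t).trans (sub_eq_zero.2 htx.symm))
  have := T.add_mem (hf y) ht
  rwa [hy, sub_add_cancel] at this

/-! ### Reflection onto the right orthogonal category -/

/-- `r : M ⟶ N` looks like an isomorphism to all objects right orthogonal to `E`. -/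
structure IsReflStep (E : QRep k V) {M N : QRep k V} (r : M ⟶ N) : Prop where
  fg : IsFG N
  bijective : ∀ L : QRep k V, Orth E L → Function.Bijective fun g : N ⟶ L => r ≫ g
  app_bijective : ∀ v : V, Subsingleton (fib E v) → Function.Bijective (comp r v)

theorem IsReflStep.id {E M : QRep k V} (hM : IsFG M) : IsReflStep E (𝟙 M) where
  fg := hM
  bijective L _ := by simpa using! Function.bijective_id (α := M ⟶ L)
  app_bijective v _ := Function.bijective_id

theorem IsReflStep.comp {E M N L : QRep k V} {r : M ⟶ N} {s : N ⟶ L} (hr : IsReflStep E r)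
    (hs : IsReflStep E s) : IsReflStep E (r ≫ s) where
  fg := hs.fg
  bijective T hT := by
    have := (hr.bijective T hT).comp (hs.bijective T hT)
    simpa [Function.comp_def] using this
  app_bijective v hv := (hs.app_bijective v hv).comp (hr.app_bijective v hv)

/-- In Hom(E, L) → Hom(N, L) → Hom(M, L) → Ext¹(E, L) both outer terms vanish when `L` is right
orthogonal to `E`. -/
theorem isReflStep_of_shortExact {E M N : QRep k V} (hE : IsFG E) (hM : IsFG M) {i : M ⟶ N}
    {q : N ⟶ E} {w : i ≫ q = 0} (hS : (ShortComplex.mk i q w).ShortExact) : IsReflStep E i where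
  fg := IsFG.of_shortExact hS hM hE
  bijective L hL := by
    have := hL.1
    have := hL.2
    have : Epi q := hS.epi_g
    constructor
    · intro g g' h
      have h0 : i ≫ (g - g') = 0 := by
        rw [Preadditive.comp_sub, sub_eq_zero]; exact h
      have h1 := hS.exact.g_desc (g - g') h0
      rw [Subsingleton.elim (hS.exact.desc (g - g') h0) 0, comp_zero] at h1
      exact (sub_eq_zero.1 h1.symm)
    · intro f
      obtain ⟨x, hx⟩ := Abelian.Ext.contravariant_sequence_exact₁ hS L (Abelian.Ext.mk₀ f) (n₁ := 1)
        rfl (Subsingleton.elim _ _)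
      obtain ⟨g, rfl⟩ := (Abelian.Ext.mk₀_bijective _ _).2 x
      rw [Abelian.Ext.mk₀_comp_mk₀] at hx
      exact ⟨g, (Abelian.Ext.mk₀_bijective _ _).1 hx⟩
  app_bijective v hv := by
    exact ⟨(shortExact_app hS v).1, fun x => (shortExact_app hS v).2.2 x
      (Subsingleton.elim (α := fib E v) _ _)⟩

/-- A map from `M` to a right orthogonal object kills `f` because Hom(E, L) = 0; where `E` has zero
fibre, so does the image of `f`. -/
theorem isReflStep_cokernel {E M : QRep k V} (hM : IsFG M) (f : E ⟶ M) :
    IsReflStep E (cokernel.π f) where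
  fg := hM.of_epi (cokernel.π f)
  bijective L hL := by
    have := hL.1
    refine ⟨fun g g' h => (cancel_epi (cokernel.π f)).1 h, fun g => ?_⟩
    exact ⟨cokernel.desc f g (Subsingleton.elim _ _), cokernel.π_desc _ _ _⟩
  app_bijective v hv := by
    refine ⟨?_, (epi_iff_app (cokernel.π f)).1 inferInstance v⟩
    refine (injective_iff_map_eq_zero _).2 fun x hx => ?_
    obtain ⟨y, rfl⟩ := exact_app (ShortComplex.exact_cokernel f) _ x hx
    rw [Subsingleton.elim (α := fib E v) y 0]
    exact map_zero (QuiverProj.comp f v)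

/-- The postcomposition `Ext¹(E, M) → Ext¹(E, N)` with `f : M ⟶ N`. -/
def ext1Map (E : QRep k V) {M N : QRep k V} (f : M ⟶ N) : Ext1 E M →ₗ[k] Ext1 E N :=
  (Abelian.Ext.mk₀ f).postcompOfLinear k E (add_zero 1)

theorem ext1Map_apply (E : QRep k V) {M N : QRep k V} (f : M ⟶ N) (x : Ext1 E M) :
    ext1Map E f x = x.comp (Abelian.Ext.mk₀ f) (add_zero 1) := rfl

theorem finrank_lt_of_surjective {W W' : Type*} [AddCommGroup W] [Module k W] [AddCommGroup W']
    [Module k W'] [Module.Finite k W] (f : W →ₗ[k] W') (hf : Function.Surjective f) {x : W}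
    (hx : x ≠ 0) (hfx : f x = 0) : Module.finrank k W' < Module.finrank k W := by
  have h := f.finrank_range_add_finrank_ker
  rw [LinearMap.range_eq_top.2 hf, finrank_top] at h
  have : 0 < Module.finrank k (LinearMap.ker f) :=
    Module.finrank_pos_iff_exists_ne_zero.2 ⟨⟨x, hfx⟩, fun h => hx (congrArg Subtype.val h)⟩
  omega

/-- One nonzero class in `Ext¹(E, M)` can be killed by an extension of `E` by `M`. -/
theorem IsExceptional.exists_step {E : QRep k V} (hE : IsExceptional E) {M : QRep k V}
    [Module.Finite k (Ext1 E M)] (hM : IsFG M) {x : Ext1 E M} (hx : x ≠ 0) :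
    ∃ (N : QRep k V) (i : M ⟶ N), Mono i ∧ IsReflStep E i ∧
      Module.finrank k (Ext1 E N) < Module.finrank k (Ext1 E M) ∧
      ∀ g : E ⟶ N, ∃ f : E ⟶ M, f ≫ i = g := by
  obtain ⟨N, i, q, w, hS, rfl⟩ := exists_extClass_eq x
  have := hE.ext_self
  refine ⟨N, i, hS.mono_f, isReflStep_of_shortExact hE.fg hM hS, ?_, ?_⟩
  · refine finrank_lt_of_surjective (ext1Map E i) ?_ hx hS.extClass_comp
    intro y
    exact Abelian.Ext.covariant_sequence_exact₂ E hS y (Subsingleton.elim _ _)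
  · intro g
    -- `g ≫ q` is a scalar c; pulling the extension class back along `q` gives zero, so c
    -- annihilates a nonzero class and must be 0.
    have h1 : g ≫ q = 0 := by
      have hid : 𝟙 E ≠ 0 := fun h0 => by
        apply hx
        rw [← Abelian.Ext.mk₀_id_comp hS.extClass, h0, Abelian.Ext.mk₀_zero,
          Abelian.Ext.zero_comp]
      obtain ⟨c, hc⟩ := exists_smul_eq_of_finrank_eq_one hE.finrank_end hid (g ≫ q)
      have h2 : (Abelian.Ext.mk₀ (g ≫ q)).comp hS.extClass (zero_add 1) = 0 := by
        rw [← Abelian.Ext.mk₀_comp_mk₀_assoc]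
        have := hS.comp_extClass
        dsimp only at this
        rw [this, Abelian.Ext.comp_zero]
      rw [← hc, Abelian.Ext.mk₀_smul, Abelian.Ext.smul_comp, Abelian.Ext.mk₀_id_comp,
        smul_eq_zero] at h2
      rw [← hc, h2.resolve_right hx, zero_smul]
    have : Mono i := hS.mono_f
    exact ⟨hS.exact.lift g h1, hS.exact.lift_f g h1⟩

/-- `M` embeds into a finitely generated representation `N` with `Ext¹(E, N) = 0`. -/
theorem IsExceptional.exists_ext_vanishing {E : QRep k V} (hE : IsExceptional E)
    (hfin : ∀ X : QRep k V, IsFG X → Module.Finite k (Ext1 E X)) (n : ℕ) :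
    ∀ M : QRep k V, IsFG M → Module.finrank k (Ext1 E M) = n →
    ∃ (N : QRep k V) (i : M ⟶ N), Mono i ∧ IsReflStep E i ∧ Subsingleton (Ext1 E N) ∧
      ∀ g : E ⟶ N, ∃ f : E ⟶ M, f ≫ i = g := by
  induction n using Nat.strong_induction_on with
  | _ n ih =>
    rintro M hM rfl
    have := hfin M hM
    by_cases h : Subsingleton (Ext1 E M)
    · exact ⟨M, 𝟙 M, inferInstance, .id hM, h, fun g => ⟨g, Category.comp_id g⟩⟩
    · have := not_subsingleton_iff_nontrivial.1 h
      obtain ⟨x, hx⟩ := exists_ne (0 : Ext1 E M)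
      obtain ⟨N, i, hi, hr, hlt, hl⟩ := hE.exists_step hM hx
      obtain ⟨L, j, hj, hs, hL, hl'⟩ := ih _ hlt N hr.fg rfl
      refine ⟨L, i ≫ j, mono_comp i j, hr.comp hs, hL, fun g => ?_⟩
      obtain ⟨f, rfl⟩ := hl' g
      obtain ⟨f, rfl⟩ := hl f
      exact ⟨f, (Category.assoc _ _ _).symm⟩

/-- If `Ext¹(E, M) = 0`, then `M` has a quotient right orthogonal to `E`. -/
theorem IsExceptional.exists_hom_vanishing {E : QRep k V} (hE : IsExceptional E)
    (hfin : ∀ X : QRep k V, IsFG X → Module.Finite k (E ⟶ X)) (n : ℕ) :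
    ∀ M : QRep k V, IsFG M → Subsingleton (Ext1 E M) → Module.finrank k (E ⟶ M) = n →
    ∃ (N : QRep k V) (r : M ⟶ N), IsReflStep E r ∧ Orth E N := by
  induction n using Nat.strong_induction_on with
  | _ n ih =>
    rintro M hM hext rfl
    have := hfin M hM
    by_cases h : Subsingleton (E ⟶ M)
    · exact ⟨M, 𝟙 M, .id hM, h, hext⟩
    · have := not_subsingleton_iff_nontrivial.1 h
      obtain ⟨f, hf⟩ := exists_ne (0 : E ⟶ M)
      have := hE.ext_self
      have hext' : Subsingleton (Ext1 E (cokernel f)) := subsingleton_ext1_of_epi E (cokernel.π f)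
      have hr := isReflStep_cokernel hM f
      -- This kernel is the image of `f`, a quotient of `E`, so heredity and Ext¹(E, E) = 0 apply.
      -- Every map from `E` to the cokernel then lifts to `M`, while `f` itself dies there.
      have hK : Subsingleton (Ext1 E (kernel (cokernel.π f))) := by
        have : Epi (kernel.lift (cokernel.π f) f (cokernel.condition f)) :=
          inferInstanceAs (Epi (Abelian.factorThruImage f))
        exact subsingleton_ext1_of_epi E (kernel.lift (cokernel.π f) f (cokernel.condition f))
      have hlt : Module.finrank k (E ⟶ cokernel f) < Module.finrank k (E ⟶ M) := by
        refine finrank_lt_of_surjective (Linear.rightComp k E (cokernel.π f)) ?_ hf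
          (cokernel.condition f)
        intro g
        obtain ⟨x, hx⟩ := Abelian.Ext.covariant_sequence_exact₃ E
          (shortExact_kernel (cokernel.π f)) (Abelian.Ext.mk₀ g) (n₁ := 1) rfl
          (Subsingleton.elim _ _)
        obtain ⟨t, rfl⟩ := (Abelian.Ext.mk₀_bijective _ _).2 x
        rw [Abelian.Ext.mk₀_comp_mk₀] at hx
        exact ⟨t, (Abelian.Ext.mk₀_bijective _ _).1 hx⟩
      obtain ⟨N, s, hs, hN⟩ := ih _ hlt _ hr.fg hext' rfl
      exact ⟨N, cokernel.π f ≫ s, hr.comp hs, hN⟩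

/-- The order matters: Ext¹ is killed first, because its vanishing is inherited by the quotients
that kill Hom. -/
theorem IsExceptional.exists_reflection {E : QRep k V} (hE : IsExceptional E)
    (hfin : IsHomFinite E) {M : QRep k V} (hM : IsFG M) :
    ∃ (N : QRep k V) (r : M ⟶ N), IsReflStep E r ∧ Orth E N := by
  obtain ⟨N, i, _, hi, hN, _⟩ := hE.exists_ext_vanishing hfin.ext_right _ M hM rfl
  obtain ⟨L, r, hr, hL⟩ := hE.exists_hom_vanishing hfin.hom_right _ N hi.fg hN rfl
  exact ⟨L, i ≫ r, hi.comp hr, hL⟩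

/-- The inclusion of the right orthogonal category has a left adjoint. -/
theorem IsExceptional.isRightAdjoint {E : QRep k V} (hE : IsExceptional E)
    (hfin : IsHomFinite E) : (rightOrthIncl E).IsRightAdjoint := by
  have (M : FGRep k V) : HasInitial (StructuredArrow M (rightOrthIncl E)) := by
    obtain ⟨N, r, hr, hN⟩ := hE.exists_reflection hfin M.2
    let N' : (rightOrth E).FullSubcategory := ⟨N, hr.fg, hN⟩
    let A : StructuredArrow M (rightOrthIncl E) :=
      StructuredArrow.mk (Y := N') (ObjectProperty.homMk r)
    have hA : ∀ B : StructuredArrow M (rightOrthIncl E), Nonempty (Unique (A ⟶ B)) := by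
      intro B
      have hB := hr.bijective B.right.obj B.right.2.2
      obtain ⟨g, hg⟩ := hB.2 B.hom.hom
      refine ⟨⟨⟨StructuredArrow.homMk (ObjectProperty.homMk g)
        (ObjectProperty.hom_ext _ hg)⟩, fun t => ?_⟩⟩
      apply StructuredArrow.ext
      apply ObjectProperty.hom_ext
      apply hB.1
      refine Eq.trans ?_ hg.symm
      exact congrArg InducedCategory.Hom.hom (StructuredArrow.w t)
    have : ∀ B : StructuredArrow M (rightOrthIncl E), Unique (A ⟶ B) := fun B => (hA B).some
    have (B : StructuredArrow M (rightOrthIncl E)) := this B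
    exact hasInitial_of_unique A
  exact isRightAdjointOfStructuredArrowInitials _

/-! ### Projective and simple representations -/

/-- The projective representation `P_v`. -/
abbrev proj (k : Type u) [Field k] {V : Type u} [Quiver.{u} V] (v : V) : QRep k V :=
  (projRep k V).obj (Opposite.op ((Paths.of V).obj v))

/-- A path, as a basis element of `P_v`. -/
def projMk (v : V) {w : Paths V} (p : (Paths.of V).obj v ⟶ w) : (proj k v).obj w :=
  ModuleCat.freeMk p

theorem projMk_map (v : V) {w x : Paths V} (p : (Paths.of V).obj v ⟶ w) (q : w ⟶ x) :
    (proj k v).map q (projMk v p) = projMk v (p ≫ q) :=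
  ModuleCat.free_map_apply _ _

/-- The morphism `P_v ⟶ M` given by an element of `M_v`. -/
def projDesc {M : QRep k V} (v : V) (x : fib M v) : proj k v ⟶ M where
  app _ := ModuleCat.freeDesc (↾fun p => M.map p x)
  naturality w₁ w₂ q := by
    apply ModuleCat.free_hom_ext
    intro p
    refine (congrArg (ModuleCat.freeDesc (↾fun p => M.map p x))
      (projMk_map (k := k) v p q)).trans ?_
    refine (ModuleCat.freeDesc_apply _ _).trans ?_
    refine (map_comp_apply M p q x).trans ?_
    exact congrArg (M.map q) (ModuleCat.freeDesc_apply (↾fun p => M.map p x) p).symm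

theorem projDesc_projMk {M : QRep k V} (v : V) (x : fib M v) {w : Paths V}
    (p : (Paths.of V).obj v ⟶ w) : (projDesc v x).app w (projMk v p) = M.map p x :=
  ModuleCat.freeDesc_apply _ _

theorem proj_hom_apply {M : QRep k V} {v : V} (f : proj k v ⟶ M) {w : Paths V}
    (p : (Paths.of V).obj v ⟶ w) : f.app w (projMk v p) = M.map p (f.app _ (projMk v (𝟙 _))) := by
  rw [← NatTrans.naturality_apply, projMk_map, Category.id_comp]

theorem proj_hom_ext {M : QRep k V} {v : V} {f g : proj k v ⟶ M}
    (h : f.app _ (projMk v (𝟙 _)) = g.app _ (projMk v (𝟙 _))) : f = g := by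
  ext w : 2
  apply ModuleCat.free_hom_ext
  intro p
  refine (proj_hom_apply f p).trans (Eq.trans ?_ (proj_hom_apply g p).symm)
  rw [h]

instance (v : V) : Projective (proj k v) where
  factors {E X} f e _ := by
    have he : Function.Surjective (comp e v) := (epi_iff_app e).1 inferInstance _
    obtain ⟨x, hx⟩ := he (comp f v (projMk v (𝟙 _)))
    refine ⟨projDesc v x, proj_hom_ext ?_⟩
    rw [comp_app_apply, projDesc_projMk, map_id_apply]
    exact hx

theorem isFG_proj (v : V) : IsFG (proj k v) := by
  refine isFG_of_finite (ι := Unit) (fun _ => (Paths.of V).obj v) (fun _ => projMk v (𝟙 _))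
    fun w => ?_
  rw [eq_top_iff]
  refine (Finsupp.basisSingleOne (R := k) (ι := (Paths.of V).obj v ⟶ w)).span_eq.symm.le.trans ?_
  refine Submodule.span_mono ?_
  rintro _ ⟨p, rfl⟩
  refine ⟨(), p, ?_⟩
  rw [projMk_map, Category.id_comp, Finsupp.coe_basisSingleOne]
  rfl

/-- Evaluation at the generator of `P_v`. -/
def projEval (M : QRep k V) (v : V) : (proj k v ⟶ M) →ₗ[k] fib M v where
  toFun f := comp f v (projMk v (𝟙 _))
  map_add' _ _ := rfl
  map_smul' _ _ := rfl

theorem projEval_bijective (M : QRep k V) (v : V) : Function.Bijective (projEval M v) :=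
  ⟨fun _ _ h => proj_hom_ext h, fun x => ⟨projDesc v x,
    (projDesc_projMk v x _).trans (map_id_apply M _ x)⟩⟩

/-- The fibre at `v` is Hom(P_v, E). -/
theorem IsHomFinite.finite_fib {E : QRep k V} (hE : IsHomFinite E) (v : V) :
    Module.Finite k (fib E v) :=
  have := hE.hom_right (proj k v) (isFG_proj v)
  have := hE.hom_left (proj k v) (isFG_proj v)
  Module.Finite.of_surjective (projEval E v) (projEval_bijective E v).2

theorem simpleRep_act (i : V) {v w : V} (a : v ⟶ w) : act (simpleRep k i) a = 0 :=
  congrArg ModuleCat.Hom.hom (Paths.lift_toPath _ a)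

theorem subsingleton_fib_simpleRep {i v : V} (h : v ≠ i) : Subsingleton (fib (simpleRep k i) v) :=
  ⟨fun _ _ => funext fun (t : PLift (v = i)) => absurd t.down h⟩

/-- The generator of `S_i`. -/
def simpleMk (k : Type u) [Field k] {V : Type u} [Quiver.{u} V] (i : V) : fib (simpleRep k i) i :=
  fun _ : PLift (i = i) => (1 : k)

theorem simpleMk_ne_zero (i : V) : simpleMk k i ≠ 0 := fun h =>
  one_ne_zero (congrFun (show (fun _ : PLift (i = i) => (1 : k)) = fun _ => 0 from h) ⟨rfl⟩)

theorem exists_smul_simpleMk {i : V} (f : fib (simpleRep k i) i) :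
    ∃ c : k, c • simpleMk k i = f :=
  ⟨(show PLift (i = i) → k from f) ⟨rfl⟩, funext fun (_ : PLift (i = i)) => mul_one _⟩

theorem simple_hom_ext {i : V} {M : QRep k V} {f g : simpleRep k i ⟶ M}
    (h : comp f i (simpleMk k i) = comp g i (simpleMk k i)) : f = g := by
  refine hom_ext_apply fun v x => ?_
  by_cases hv : v = i
  · subst hv
    obtain ⟨c, rfl⟩ := exists_smul_simpleMk x
    change comp f v _ = comp g v _
    rw [map_smul, map_smul, h]
  · have := subsingleton_fib_simpleRep (k := k) hv
    rw [Subsingleton.elim x 0]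
    exact (map_zero (comp f v)).trans (map_zero (comp g v)).symm

open Classical in
/-- The linear map from the fibre of `S_i` at `v` determined by an element of `M_i`. -/
def simpleDescAux {i : V} {M : QRep k V} (x : fib M i) (v : V) :
    fib (simpleRep k i) v →ₗ[k] fib M v :=
  if h : v = i then
    (LinearMap.toSpanSingleton k (fib M v) (h ▸ x)) ∘ₗ
      (LinearMap.proj (R := k) (φ := fun _ => k) (PLift.up h))
  else 0

theorem simpleDescAux_simpleMk {i : V} {M : QRep k V} (x : fib M i) :
    simpleDescAux x i (simpleMk k i) = x := by
  unfold simpleDescAux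
  rw [dif_pos rfl]
  exact one_smul k x

/-- An element of `M_i` killed by all arrows determines a morphism `S_i ⟶ M`. -/
def simpleDesc {i : V} {M : QRep k V} (x : fib M i)
    (hx : ∀ (w : V) (a : i ⟶ w), act M a x = 0) : simpleRep k i ⟶ M :=
  homMk (simpleDescAux x) fun v w a y => by
    rw [simpleRep_act, LinearMap.zero_apply, map_zero]
    by_cases hv : v = i
    · subst hv
      obtain ⟨c, rfl⟩ := exists_smul_simpleMk y
      rw [map_smul, simpleDescAux_simpleMk, map_smul, hx, smul_zero]
    · have := subsingleton_fib_simpleRep (k := k) hv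
      rw [Subsingleton.elim y 0, map_zero, map_zero]

theorem simpleDesc_simpleMk {i : V} {M : QRep k V} (x : fib M i)
    (hx : ∀ (w : V) (a : i ⟶ w), act M a x = 0) :
    comp (simpleDesc x hx) i (simpleMk k i) = x :=
  simpleDescAux_simpleMk x

theorem simpleDesc_mono {i : V} {M : QRep k V} {x : fib M i}
    (hx : ∀ (w : V) (a : i ⟶ w), act M a x = 0) (h0 : x ≠ 0) : Mono (simpleDesc x hx) := by
  refine (mono_iff_app _).2 fun (v : V) => (injective_iff_map_eq_zero (comp (simpleDesc x hx) v)).2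
    fun y hy => ?_
  by_cases hv : v = i
  · subst hv
    obtain ⟨c, rfl⟩ := exists_smul_simpleMk y
    have : c • x = 0 := by
      rw [← simpleDesc_simpleMk x hx, ← map_smul]; exact hy
    rw [(smul_eq_zero.1 this).resolve_right h0]
    exact zero_smul k _
  · have := subsingleton_fib_simpleRep (k := k) hv
    exact Subsingleton.elim (α := fib (simpleRep k i) v) _ _

theorem simpleRep_not_isZero (i : V) : ¬ IsZero (simpleRep k i) := fun h => by
  have h1 : 𝟙 (simpleRep k i) = 0 := h.eq_of_src _ _
  exact simpleMk_ne_zero i (congrArg (fun f => comp f i (simpleMk k i)) h1)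

theorem projDesc_simpleMk_projMk (i : V) :
    comp (projDesc i (simpleMk k i)) i (projMk (k := k) i (𝟙 _)) = simpleMk k i :=
  (projDesc_projMk i (simpleMk k i) (𝟙 _)).trans (map_id_apply _ _ _)

instance epi_projDesc_simpleMk (i : V) : Epi (projDesc i (simpleMk k i)) := by
  refine (epi_iff_app _).2 fun (v : V) x => ?_
  by_cases hv : v = i
  · subst hv
    obtain ⟨c, rfl⟩ := exists_smul_simpleMk x
    refine ⟨(c • projMk v (𝟙 _) : fib (proj k v) v), ?_⟩
    exact (map_smul (comp (projDesc v (simpleMk k v)) v) c _).trans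
      (congrArg (c • ·) (projDesc_simpleMk_projMk v))
  · have := subsingleton_fib_simpleRep (k := k) hv
    exact ⟨(0 : fib (proj k i) v), Subsingleton.elim (α := fib (simpleRep k i) v) _ _⟩

theorem isFG_simpleRep (i : V) : IsFG (simpleRep k i) :=
  (isFG_proj (k := k) i).of_epi (projDesc i (simpleMk k i))

/-! ### Exactness of the projection forces simplicity -/

/-- If `f` is not an isomorphism then Hom(E, U) = 0, since a map `E ⟶ U` with nonzero composite in
End(E) = k would split `f`. Killing Ext¹ thus embeds `U` into an object of E^⊥, and this embedding
factors through π U. Exactness embeds π U into π E = 0, so `U` would be zero. -/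
theorem IsExceptional.isIso_of_mono {E : QRep k V} (hE : IsExceptional E) (hfin : IsHomFinite E)
    {π : FGRep k V ⥤ (rightOrth E).FullSubcategory} (adj : π ⊣ rightOrthIncl E)
    (hπ : IsExactFunctor π) {U : QRep k V} (hU : IsFG U) (h0 : ¬ IsZero U) (f : U ⟶ E) [Mono f] :
    IsIso f := by
  by_contra hf
  have hid : 𝟙 E ≠ 0 := fun h => by
    have h1 := hE.finrank_end
    have : Subsingleton (E ⟶ E) := ⟨fun a b => by
      rw [← Category.id_comp a, ← Category.id_comp b, h, zero_comp, zero_comp]⟩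
    rw [Module.finrank_zero_of_subsingleton] at h1
    exact zero_ne_one h1
  have hEU : Subsingleton (E ⟶ U) := by
    refine subsingleton_of_forall_eq 0 fun g => ?_
    obtain ⟨c, hc⟩ := exists_smul_eq_of_finrank_eq_one hE.finrank_end hid (g ≫ f)
    by_cases hc0 : c = 0
    · rw [← cancel_mono f, ← hc, hc0, zero_smul, zero_comp]
    · refine absurd ?_ hf
      have : (c⁻¹ • g) ≫ f = 𝟙 E := by
        rw [Linear.smul_comp, ← hc, smul_smul, inv_mul_cancel₀ hc0, one_smul]
      have : Epi f := epi_of_epi_fac this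
      exact isIso_of_mono_of_epi f
  -- All maps from `E` to `N` come from Hom(E, U) = 0, so `N` already lies in E^⊥ with no quotient
  -- taken, and `i` remains mono.
  obtain ⟨N, i, hi, hr, hN, hl⟩ := hE.exists_ext_vanishing hfin.ext_right _ U hU rfl
  have hN' : Orth E N := ⟨⟨fun g g' => by
    obtain ⟨t, rfl⟩ := hl g
    obtain ⟨t', rfl⟩ := hl g'
    rw [Subsingleton.elim t t']⟩, hN⟩
  let X : FGRep k V := ⟨U, hU⟩
  let Y : FGRep k V := ⟨E, hE.fg⟩
  let Z : FGRep k V := ⟨cokernel f, hE.fg.of_epi (cokernel.π f)⟩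
  let N₁ : (rightOrth E).FullSubcategory := ⟨N, hr.fg, hN'⟩
  obtain ⟨w', hw⟩ := hπ X Y Z (ObjectProperty.homMk f) (ObjectProperty.homMk (cokernel.π f))
    (cokernel.condition f) (shortExact_cokernel f)
  have hmono := hw.mono_f
  dsimp only at hmono
  have hY : 𝟙 (π.obj Y).obj = 0 := by
    have : 𝟙 (π.obj Y) = 0 := by
      apply (adj.homEquiv _ _).injective
      apply ObjectProperty.hom_ext
      have := (π.obj Y).2.2.1
      exact Subsingleton.elim (α := (E ⟶ (π.obj Y).obj)) _ _
    exact congrArg InducedCategory.Hom.hom this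
  have hX : 𝟙 (π.obj X).obj = 0 := by
    rw [← cancel_mono (π.map (ObjectProperty.homMk f : X ⟶ Y)).hom, zero_comp, Category.id_comp,
      ← Category.comp_id (π.map _).hom, hY, comp_zero]
  let t : X ⟶ (rightOrthIncl E).obj N₁ := ObjectProperty.homMk i
  have ht : ((adj.homEquiv X N₁).symm t).hom = 0 := by
    rw [← Category.id_comp ((adj.homEquiv X N₁).symm t).hom, hX, zero_comp]
  have ht' := congrArg InducedCategory.Hom.hom ((adj.homEquiv X N₁).apply_symm_apply t)
  rw [Adjunction.homEquiv_unit] at ht'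
  have hi0 : i = 0 := by
    refine ht'.symm.trans ?_
    refine (congrArg ((adj.unit.app X).hom ≫ ·) ht).trans comp_zero
  apply h0
  rw [IsZero.iff_id_eq_zero, ← cancel_mono i, hi0, comp_zero, comp_zero]

/-- If `Ext¹(E, E) = 0` and `End(E)` is one-dimensional, then some element of `E` at a vertex is
killed by all arrows. -/
theorem IsExceptional.exists_killed [Finite V] [∀ v w : V, Finite (v ⟶ w)] {E : QRep k V}
    (hE : IsExceptional E) (hfin : IsHomFinite E) :
    ∃ (v : V) (x : fib E v), x ≠ 0 ∧ ∀ (w : V) (a : v ⟶ w), act E a x = 0 := by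
  by_contra! hcon
  have := hfin.finite_fib
  have := hE.ext_self
  have := Fintype.ofFinite V
  have (v w : V) := Fintype.ofFinite (v ⟶ w)
  -- The kernel of `D` is End(E), and `exists_coboundary` makes `D` surjective because Ext¹(E, E) =
  -- 0.
  let D : (∀ v : V, fib E v →ₗ[k] fib E v) →ₗ[k]
      (∀ (v : V) (a : Σ w : V, v ⟶ w), fib E v →ₗ[k] fib E a.1) :=
    { toFun h v a := h a.1 ∘ₗ act E a.2 - act E a.2 ∘ₗ h v
      map_add' h h' := by
        ext v a x
        simp only [Pi.add_apply, LinearMap.sub_apply, LinearMap.comp_apply, LinearMap.add_apply,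
          map_add]
        abel
      map_smul' c h := by
        ext v a x
        simp [smul_sub] }
  have hD : Function.Surjective D := by
    intro ψ
    obtain ⟨h, hh⟩ := exists_coboundary (fun v w a => ψ v ⟨w, a⟩)
    refine ⟨h, ?_⟩
    ext v a x
    exact (hh v a.1 a.2 x).symm
  let K : (E ⟶ E) →ₗ[k] LinearMap.ker D :=
    { toFun f := ⟨fun v => comp f v, by
        rw [LinearMap.mem_ker]
        ext v a x
        exact sub_eq_zero.2 (comp_act f a.2 x)⟩
      map_add' _ _ := rfl
      map_smul' _ _ := rfl }
  have hK : Function.Bijective K := by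
    constructor
    · intro f g hfg
      refine hom_ext_apply fun v x => ?_
      exact LinearMap.congr_fun (congrFun (congrArg Subtype.val hfg) v) x
    · rintro ⟨h, hh⟩
      refine ⟨homMk h fun v w a x => ?_, rfl⟩
      exact sub_eq_zero.1 (LinearMap.congr_fun (congrFun (congrFun hh v) ⟨w, a⟩) x)
  have hK1 := (LinearEquiv.ofBijective K hK).finrank_eq
  rw [hE.finrank_end] at hK1
  -- With d_v = dim E_v this becomes the Euler form identity Σ_{v → w} d_v d_w + 1 = Σ_v d_v².
  have h1 := D.finrank_range_add_finrank_ker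
  rw [LinearMap.range_eq_top.2 hD, finrank_top, ← hK1, Module.finrank_pi_fintype,
    Module.finrank_pi_fintype] at h1
  simp only [Module.finrank_pi_fintype, Module.finrank_linearMap, ← Finset.mul_sum] at h1
  -- Without killed vectors the arrows leaving `v` are jointly injective on E_v. Multiplying by d_v
  -- and summing contradicts the Euler form identity.
  have h2 : ∀ v : V, Module.finrank k (fib E v) ≤
      ∑ a : Σ w : V, v ⟶ w, Module.finrank k (fib E a.1) := by
    intro v
    rw [← Module.finrank_pi_fintype k (M := fun a : Σ w : V, v ⟶ w => fib E a.1)]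
    refine LinearMap.finrank_le_finrank_of_injective
      (f := LinearMap.pi fun a : Σ w : V, v ⟶ w => act E a.2) ?_
    refine (injective_iff_map_eq_zero _).2 fun x hx => ?_
    by_contra hx0
    obtain ⟨w, a, ha⟩ := hcon v x hx0
    exact ha (congrFun hx ⟨w, a⟩)
  have h3 := Finset.sum_le_sum fun (v : V) (_ : v ∈ Finset.univ) =>
    Nat.mul_le_mul_left (Module.finrank k (fib E v)) (h2 v)
  omega

theorem IsExceptional.exists_iso_simpleRep [Finite V] [∀ v w : V, Finite (v ⟶ w)] {E : QRep k V}
    (hE : IsExceptional E) (hfin : IsHomFinite E)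
    {π : FGRep k V ⥤ (rightOrth E).FullSubcategory} (adj : π ⊣ rightOrthIncl E)
    (hπ : IsExactFunctor π) : ∃ i : V, Nonempty (E ≅ simpleRep k i) := by
  obtain ⟨v, x, hx, ha⟩ := hE.exists_killed hfin
  have := simpleDesc_mono ha hx
  have := hE.isIso_of_mono hfin adj hπ (isFG_simpleRep v) (simpleRep_not_isZero v)
    (simpleDesc x ha)
  exact ⟨v, ⟨(asIso (simpleDesc x ha)).symm⟩⟩

/-! ### The projective resolution of a simple representation -/

/-- The arrows starting at `i`. -/
abbrev Out (i : V) : Type u := Σ w : V, i ⟶ w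

/-- Prefixing a path with an arrow starting at `i`. -/
def prefixArrow (i : V) (v : Paths V) (x : Σ a : Out i, ((Paths.of V).obj a.1 ⟶ v)) :
    (Paths.of V).obj i ⟶ v :=
  (Paths.of V).map x.1.2 ≫ x.2

/-- Paths grow by appending arrows at the end, so recovering the first arrow takes an induction on
the remaining path; comparing lengths excludes the mixed cases. -/
theorem toPath_comp_injective {i v w : V} {a : i ⟶ w} {p : Quiver.Path w v} :
    ∀ {w' : V} {a' : i ⟶ w'} {p' : Quiver.Path w' v}, a.toPath.comp p = a'.toPath.comp p' →
      (⟨⟨w, a⟩, p⟩ : Σ a : Out i, Quiver.Path a.1 v) = ⟨⟨w', a'⟩, p'⟩ := by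
  induction p with
  | nil =>
    intro w' a' p' h
    have hl := congrArg Quiver.Path.length h
    rw [Quiver.Path.length_comp, Quiver.Path.length_comp] at hl
    simp only [Quiver.Path.length_toPath, Quiver.Path.length_nil] at hl
    cases p' with
    | nil =>
      have := eq_of_heq (Quiver.Path.hom_heq_of_cons_eq_cons
        (show Quiver.Path.nil.cons a = Quiver.Path.nil.cons a' from h))
      subst this
      rfl
    | cons p' e => rw [Quiver.Path.length_cons] at hl; omega
  | cons p e ih =>
    intro w' a' p' h
    cases p' with
    | nil =>
      have hl := congrArg Quiver.Path.length h
      rw [Quiver.Path.length_comp, Quiver.Path.length_comp] at hl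
      simp only [Quiver.Path.length_toPath, Quiver.Path.length_nil, Quiver.Path.length_cons] at hl
      omega
    | cons p' e' =>
      rw [Quiver.Path.comp_cons, Quiver.Path.comp_cons] at h
      have hb := Quiver.Path.obj_eq_of_cons_eq_cons h
      subst hb
      have h1 := eq_of_heq (Quiver.Path.heq_of_cons_eq_cons h)
      have h2 := eq_of_heq (Quiver.Path.hom_heq_of_cons_eq_cons h)
      subst h2
      have := ih h1
      cases this
      rfl

theorem prefixArrow_injective (i : V) (v : Paths V) : Function.Injective (prefixArrow i v) := by
  rintro ⟨⟨w, a⟩, p⟩ ⟨⟨w', a'⟩, p'⟩ h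
  exact toPath_comp_injective (V := V) (v := v) (a := a) (p := p) (a' := a') (p' := p') h

theorem eq_prefixArrow_or {i v : V} (p : (Paths.of V).obj i ⟶ (Paths.of V).obj v) :
    (∃ x, prefixArrow i _ x = p) ∨ (v = i ∧ p ≍ 𝟙 ((Paths.of V).obj i)) := by
  cases h : Quiver.Path.length (V := V) p with
  | zero =>
    right
    have := Quiver.Path.eq_of_length_zero (V := V) p h
    subst this
    exact ⟨rfl, heq_of_eq (Quiver.Path.eq_nil_of_length_zero (V := V) p h)⟩
  | succ n =>
    left
    obtain ⟨c, f, q, -, hq⟩ := Quiver.Path.eq_toPath_comp_of_length_eq_succ (V := V) p h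
    exact ⟨⟨⟨c, f⟩, q⟩, hq.symm⟩

/-- The direct sum of the `P_w` over the arrows `i ⟶ w`. -/
def starRep (k : Type u) [Field k] {V : Type u} [Quiver.{u} V] (i : V) : QRep k V where
  obj v := (ModuleCat.free k).obj (Σ a : Out i, ((Paths.of V).obj a.1 ⟶ v))
  map q := (ModuleCat.free k).map (↾fun x => ⟨x.1, x.2 ≫ q⟩)
  map_id v := by
    apply ModuleCat.free_hom_ext
    intro x
    rw [ModuleCat.free_map_apply]
    simp
  map_comp p q := by
    apply ModuleCat.free_hom_ext
    intro x
    rw [ModuleCat.free_map_apply, ModuleCat.comp_apply, ModuleCat.free_map_apply,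
      ModuleCat.free_map_apply]
    simp

/-- The basis element of `starRep` given by an arrow followed by a path. -/
def starMk {i : V} (a : Out i) {v : Paths V} (p : (Paths.of V).obj a.1 ⟶ v) :
    (starRep k i).obj v :=
  ModuleCat.freeMk (R := k) (X := Σ a : Out i, ((Paths.of V).obj a.1 ⟶ v)) ⟨a, p⟩

theorem starMk_map {i : V} (a : Out i) {v w : Paths V} (p : (Paths.of V).obj a.1 ⟶ v)
    (q : v ⟶ w) : (starRep k i).map q (starMk a p) = starMk a (p ≫ q) :=
  ModuleCat.free_map_apply _ _

/-- The morphism from `starRep` given by elements at the targets of the arrows. -/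
def starDesc {M : QRep k V} {i : V} (y : ∀ a : Out i, fib M a.1) : starRep k i ⟶ M where
  app _ := ModuleCat.freeDesc (↾fun x => M.map x.2 (y x.1))
  naturality v w q := by
    apply ModuleCat.free_hom_ext
    rintro ⟨a, p⟩
    refine (congrArg (ModuleCat.freeDesc (↾fun x => M.map x.2 (y x.1)))
      (starMk_map (k := k) a p q)).trans ?_
    refine (ModuleCat.freeDesc_apply _ _).trans ?_
    refine (map_comp_apply M p q (y a)).trans ?_
    exact congrArg (M.map q) (ModuleCat.freeDesc_apply
      (↾fun x : (Σ a : Out i, ((Paths.of V).obj a.1 ⟶ v)) => M.map x.2 (y x.1)) ⟨a, p⟩).symm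

theorem starDesc_starMk {M : QRep k V} {i : V} (y : ∀ a : Out i, fib M a.1) (a : Out i)
    {v : Paths V} (p : (Paths.of V).obj a.1 ⟶ v) :
    (starDesc y).app v (starMk a p) = M.map p (y a) :=
  ModuleCat.freeDesc_apply _ _

theorem star_hom_ext {M : QRep k V} {i : V} {f g : starRep k i ⟶ M}
    (h : ∀ a : Out i, comp f a.1 (starMk a (𝟙 _)) = comp g a.1 (starMk a (𝟙 _))) : f = g := by
  ext v : 2
  apply ModuleCat.free_hom_ext
  rintro ⟨a, p⟩
  have : ∀ f : starRep k i ⟶ M, f.app v (starMk a p) = M.map p (comp f a.1 (starMk a (𝟙 _))) := by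
    intro f
    refine Eq.trans ?_ (NatTrans.naturality_apply f p (starMk a (𝟙 _)))
    rw [starMk_map, Category.id_comp]
  refine (this f).trans (Eq.trans ?_ (this g).symm)
  rw [h]

theorem starDesc_comp {M N : QRep k V} {i : V} (y : ∀ a : Out i, fib M a.1) (f : M ⟶ N) :
    starDesc y ≫ f = starDesc fun a => comp f a.1 (y a) := by
  refine star_hom_ext fun a => ?_
  have h1 := starDesc_starMk (k := k) y a (𝟙 _)
  have h2 := starDesc_starMk (k := k) (fun a => comp f a.1 (y a)) a (𝟙 _)
  rw [map_id_apply] at h1 h2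
  exact (congrArg (comp f a.1) h1).trans h2.symm

theorem starDesc_one {M : QRep k V} {i : V} (y : ∀ a : Out i, fib M a.1) (a : Out i) :
    comp (starDesc y) a.1 (starMk a (𝟙 _)) = y a :=
  (starDesc_starMk y a (𝟙 _)).trans (map_id_apply M _ _)

/-- The inclusion of `starRep` into `P_i`. -/
def starIncl (k : Type u) [Field k] {V : Type u} [Quiver.{u} V] (i : V) :
    starRep k i ⟶ proj k i :=
  starDesc fun a => projMk i ((Paths.of V).map a.2)

/-- Identifies the fibre map as the linearisation of `prefixArrow`, so that its injectivity reduces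
to paths. -/
theorem starIncl_app (i : V) (v : Paths V) :
    (starIncl k i).app v = (ModuleCat.free k).map (↾prefixArrow i v) := by
  apply ModuleCat.free_hom_ext
  rintro ⟨a, p⟩
  refine Eq.trans ?_ (ModuleCat.free_map_apply _ _).symm
  refine (starDesc_starMk _ a p).trans ?_
  rw [projMk_map]
  rfl

theorem starIncl_projDesc {M : QRep k V} {i : V} (x : fib M i) :
    starIncl k i ≫ projDesc i x = starDesc fun a => act M a.2 x := by
  rw [starIncl, starDesc_comp]
  congr 1
  funext a
  exact projDesc_projMk i x _

theorem starIncl_comp_projDesc_simpleMk (i : V) :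
    starIncl k i ≫ projDesc i (simpleMk k i) = 0 := by
  rw [starIncl_projDesc]
  refine star_hom_ext fun a => ?_
  rw [starDesc_one, simpleRep_act]
  rfl

/-- The kernel of P_i → S_i is spanned by the nontrivial paths, and these correspond bijectively to
pairs of an arrow leaving `i` and a path. -/
theorem starRep_shortExact (i : V) :
    (ShortComplex.mk _ _ (starIncl_comp_projDesc_simpleMk (k := k) i)).ShortExact := by
  refine shortExact_mk _ (fun v => ?_) ((epi_iff_app _).1 inferInstance) fun (v : V) x hx => ?_
  · rw [starIncl_app]
    exact Finsupp.mapDomain_injective (prefixArrow_injective i v)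
  · have hr : ∀ z, ∃ t, (starIncl k i).app ((Paths.of V).obj v)
        (starMk (k := k) (Sigma.fst z) (Sigma.snd z)) = t ∧ t = projMk i (prefixArrow i _ z) := by
      intro z
      refine ⟨_, rfl, ?_⟩
      rw [starIncl_app]
      exact ModuleCat.free_map_apply _ _
    have hspan := (Finsupp.basisSingleOne (R := k)
      (ι := (Paths.of V).obj i ⟶ (Paths.of V).obj v)).span_eq
    by_cases hv : v = i
    · subst hv
      -- Modulo the image only the trivial path remains, and mapping to S_v reads off its
      -- coefficient. Oriented cycles at `v` lie in the image.
      have htop : (⊤ : Submodule k (fib (proj k v) v)) ≤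
          LinearMap.range (comp (starIncl k v) v) ⊔ k ∙ projMk v (𝟙 _) := by
        refine hspan.symm.le.trans (Submodule.span_le.2 ?_)
        rintro _ ⟨p, rfl⟩
        rw [Finsupp.coe_basisSingleOne]
        rcases eq_prefixArrow_or p with ⟨z, rfl⟩ | ⟨-, h⟩
        · obtain ⟨t, ht, h⟩ := hr z
          exact Submodule.mem_sup_left (S := LinearMap.range (comp (starIncl k v) v))
            ⟨_, ht.trans h⟩
        · obtain rfl := eq_of_heq h
          exact Submodule.mem_sup_right (T := k ∙ (projMk v (𝟙 _) : fib (proj k v) v))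
            (Submodule.mem_span_singleton_self _)
      obtain ⟨_, ⟨y, rfl⟩, _, hz, rfl⟩ := Submodule.mem_sup.1 (htop (Submodule.mem_top (x := x)))
      obtain ⟨c, rfl⟩ := Submodule.mem_span_singleton.1 hz
      have h1 : comp (projDesc v (simpleMk k v)) v (comp (starIncl k v) v y) = 0 :=
        congrArg (fun f => comp f v y) (starIncl_comp_projDesc_simpleMk (k := k) v)
      have h2 : comp (projDesc v (simpleMk k v)) v
        (comp (starIncl k v) v y + c • projMk v (𝟙 _)) = 0 := hx
      rw [map_add, h1, zero_add, map_smul, projDesc_simpleMk_projMk, smul_eq_zero] at h2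
      refine ⟨y, ?_⟩
      rw [h2.resolve_right (simpleMk_ne_zero v), zero_smul, add_zero]
      rfl
    · have htop : (⊤ : Submodule k (fib (proj k i) v)) ≤
          LinearMap.range (comp (starIncl k i) v) := by
        refine hspan.symm.le.trans (Submodule.span_le.2 ?_)
        rintro _ ⟨p, rfl⟩
        rw [Finsupp.coe_basisSingleOne]
        rcases eq_prefixArrow_or p with ⟨z, rfl⟩ | ⟨h, -⟩
        · obtain ⟨t, ht, h⟩ := hr z
          exact ⟨_, ht.trans h⟩
        · exact absurd h hv
      exact htop (Submodule.mem_top (x := x))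

/-- The action of all arrows starting at `i`. -/
def starAct (M : QRep k V) (i : V) : fib M i →ₗ[k] ∀ a : Out i, fib M a.1 :=
  LinearMap.pi fun a => act M a.2

theorem starDesc_add {M : QRep k V} {i : V} (y z : ∀ a : Out i, fib M a.1) :
    starDesc (y + z) = starDesc y + starDesc z := by
  refine star_hom_ext fun a => ?_
  refine (starDesc_one _ _).trans ?_
  exact (congrArg₂ (· + ·) (starDesc_one y a) (starDesc_one z a)).symm

theorem starDesc_smul {M : QRep k V} {i : V} (c : k) (y : ∀ a : Out i, fib M a.1) :
    starDesc (c • y) = c • starDesc y := by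
  refine star_hom_ext fun a => ?_
  refine (starDesc_one _ _).trans ?_
  exact (congrArg (c • ·) (starDesc_one y a)).symm

/-- The connecting map onto `Ext¹(S_i, M)`. -/
def starDelta (M : QRep k V) (i : V) : (∀ a : Out i, fib M a.1) →ₗ[k] Ext1 (simpleRep k i) M where
  toFun y := (starRep_shortExact (k := k) i).extClass.comp
    (Abelian.Ext.mk₀ (starDesc y)) (add_zero 1)
  map_add' y z := by rw [starDesc_add, Abelian.Ext.mk₀_add, Abelian.Ext.comp_add]
  map_smul' c y := by rw [starDesc_smul, Abelian.Ext.mk₀_smul, Abelian.Ext.comp_smul]; rfl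

theorem starDelta_apply {M : QRep k V} {i : V} (y : ∀ a : Out i, fib M a.1) :
    starDelta M i y = (starRep_shortExact (k := k) i).extClass.comp
      (Abelian.Ext.mk₀ (starDesc y)) (add_zero 1) := rfl

theorem ext1Map_starDelta {M N : QRep k V} (f : M ⟶ N) (i : V) (y : ∀ a : Out i, fib M a.1) :
    ext1Map _ f (starDelta M i y) = starDelta N i fun a => comp f a.1 (y a) := by
  rw [starDelta_apply (M := N), ← starDesc_comp, ← Abelian.Ext.mk₀_comp_mk₀, ext1Map_apply,
    starDelta_apply, Abelian.Ext.comp_assoc_of_second_deg_zero]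

theorem starDelta_surjective (M : QRep k V) (i : V) : Function.Surjective (starDelta M i) := by
  intro x
  obtain ⟨y, hy⟩ := Abelian.Ext.contravariant_sequence_exact₃ (starRep_shortExact (k := k) i) M x
    (Abelian.Ext.eq_zero_of_projective (P := proj k i) (n := 0) _) (n₀ := 0) rfl
  obtain ⟨f, rfl⟩ := (Abelian.Ext.mk₀_bijective _ _).2 y
  refine ⟨fun a => comp f a.1 (starMk a (𝟙 _)), ?_⟩
  rw [← hy, starDelta_apply, show starDesc _ = f from star_hom_ext fun a => starDesc_one _ a]

/-- The class vanishes exactly when the map from `starRep` extends to P_i, and maps P_i → M are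
elements of M_i. -/
theorem starDelta_eq_zero_iff {M : QRep k V} {i : V} (y : ∀ a : Out i, fib M a.1) :
    starDelta M i y = 0 ↔ ∃ x, starAct M i x = y := by
  constructor
  · intro h
    obtain ⟨t, ht⟩ := Abelian.Ext.contravariant_sequence_exact₁ (starRep_shortExact (k := k) i) M
      (Abelian.Ext.mk₀ (starDesc y)) (n₁ := 1) rfl h
    obtain ⟨f, rfl⟩ := (Abelian.Ext.mk₀_bijective _ _).2 t
    rw [Abelian.Ext.mk₀_comp_mk₀] at ht
    have hf := (Abelian.Ext.mk₀_bijective _ _).1 ht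
    obtain ⟨x, rfl⟩ : ∃ x, projDesc i x = f :=
      ⟨projEval M i f, (projEval_bijective M i).1
        ((projDesc_projMk i _ (𝟙 _)).trans (map_id_apply _ _ _))⟩
    dsimp only at hf
    rw [starIncl_projDesc] at hf
    refine ⟨x, funext fun a => ?_⟩
    have := congrArg (fun f => comp f a.1 (starMk a (𝟙 _))) hf
    exact (starDesc_one _ a).symm.trans (this.trans (starDesc_one _ a))
  · rintro ⟨x, rfl⟩
    have h : starDesc (starAct M i x) = starIncl k i ≫ projDesc i x := (starIncl_projDesc x).symm
    rw [starDelta_apply, h, ← Abelian.Ext.mk₀_comp_mk₀]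
    exact (starRep_shortExact (k := k) i).extClass_comp_assoc _

theorem starAct_bijective_of_orth {M : QRep k V} {i : V} (h : Orth (simpleRep k i) M) :
    Function.Bijective (starAct M i) := by
  have := h.1
  have := h.2
  constructor
  · refine (injective_iff_map_eq_zero _).2 fun x hx => ?_
    have hx' : ∀ (w : V) (a : i ⟶ w), act M a x = 0 := fun w a => congrFun hx ⟨w, a⟩
    rw [← simpleDesc_simpleMk x hx', Subsingleton.elim (simpleDesc x hx') 0]
    rfl
  · exact fun y => (starDelta_eq_zero_iff y).1 (Subsingleton.elim _ _)

theorem finrank_fib_simpleRep [DecidableEq V] (j w : V) :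
    Module.finrank k (fib (simpleRep k j) w) = if w = j then 1 else 0 := by
  have : Fintype (PLift (w = j)) := Fintype.ofFinite _
  change Module.finrank k (PLift (w = j) → k) = _
  rw [Module.finrank_fintype_fun_eq_card]
  split_ifs with h
  · exact Fintype.card_eq_one_iff.2 ⟨⟨h⟩, fun _ => rfl⟩
  · exact Fintype.card_eq_zero_iff.2 ⟨fun t => h t.down⟩

instance (j w : V) : Module.Finite k (fib (simpleRep k j) w) :=
  inferInstanceAs (Module.Finite k (PLift (w = j) → k))

/-- All arrows act by zero on S_j, so `starDelta` is an isomorphism; its source has one line for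
each arrow from `i` to `j`. -/
theorem finite_finrank_ext1_simpleRep [Finite V] [∀ v w : V, Finite (v ⟶ w)] (i j : V) :
    Module.Finite k (Ext1 (simpleRep k i) (simpleRep k j)) ∧
      Module.finrank k (Ext1 (simpleRep k i) (simpleRep k j)) = arrowCount i j := by
  classical
  have := Fintype.ofFinite V
  have (v w : V) := Fintype.ofFinite (v ⟶ w)
  have hinj : Function.Injective (starDelta (simpleRep k j) i) := by
    refine (injective_iff_map_eq_zero _).2 fun y hy => ?_
    obtain ⟨x, rfl⟩ := (starDelta_eq_zero_iff y).1 hy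
    funext a
    exact LinearMap.congr_fun (simpleRep_act j a.2) x
  let e := LinearEquiv.ofBijective _ ⟨hinj, starDelta_surjective (simpleRep k j) i⟩
  refine ⟨Module.Finite.equiv e, ?_⟩
  rw [← e.finrank_eq, Module.finrank_pi_fintype, arrowCount, Nat.card_eq_fintype_card]
  simp only [finrank_fib_simpleRep]
  refine (Fintype.sum_sigma _).trans ((Finset.sum_eq_single j (fun w _ hw => ?_)
    fun h => absurd (Finset.mem_univ j) h).trans ?_)
  · exact Finset.sum_eq_zero fun _ _ => if_neg hw
  · exact (Finset.sum_congr rfl fun _ _ => if_pos rfl).trans (Fintype.card_eq_sum_ones).symm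

theorem isEmpty_hom_of_subsingleton_ext1 [Finite V] [∀ v w : V, Finite (v ⟶ w)] {i j : V}
    (h : Subsingleton (Ext1 (simpleRep k i) (simpleRep k j))) : IsEmpty (i ⟶ j) := by
  have h1 := (finite_finrank_ext1_simpleRep (k := k) i j).2
  rw [Module.finrank_zero_of_subsingleton] at h1
  exact (Finite.card_eq_zero_iff).1 h1.symm

/-! ### Exactness of the projection through a simple representation -/

/-- The unit and the constructed reflection are both universal, hence differ by an isomorphism, and
the latter is bijective at `v`. -/
theorem IsExceptional.unit_app_bijective {E : QRep k V} (hE : IsExceptional E)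
    (hfin : IsHomFinite E) {π : FGRep k V ⥤ (rightOrth E).FullSubcategory}
    (adj : π ⊣ rightOrthIncl E) (M : FGRep k V) {v : V} (hv : Subsingleton (fib E v)) :
    Function.Bijective (comp (adj.unit.app M).hom v) := by
  obtain ⟨N, r, hr, hN⟩ := hE.exists_reflection hfin M.2
  let N₁ : (rightOrth E).FullSubcategory := ⟨N, hr.fg, hN⟩
  let r₁ : M ⟶ (rightOrthIncl E).obj N₁ := ObjectProperty.homMk r
  let t := (adj.homEquiv M N₁).symm r₁
  have ht : (adj.unit.app M).hom ≫ t.hom = r := by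
    have := congrArg InducedCategory.Hom.hom ((adj.homEquiv M N₁).apply_symm_apply r₁)
    rw [Adjunction.homEquiv_unit] at this
    exact this
  obtain ⟨s, hs⟩ := (hr.bijective (π.obj M).obj (π.obj M).2.2).2 (adj.unit.app M).hom
  dsimp only at hs
  have hst : s ≫ t.hom = 𝟙 N := by
    apply (hr.bijective N hN).1
    dsimp only
    rw [← Category.assoc, hs, ht, Category.comp_id]
  have hts : t.hom ≫ s = 𝟙 _ := by
    let s₁ : N₁ ⟶ π.obj M := ObjectProperty.homMk s
    have : t ≫ s₁ = 𝟙 _ := by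
      apply (adj.homEquiv _ _).injective
      rw [Adjunction.homEquiv_unit, Adjunction.homEquiv_unit]
      apply ObjectProperty.hom_ext
      refine Eq.trans (b := (adj.unit.app M).hom ≫ t.hom ≫ s) rfl ?_
      refine Eq.trans ?_ (Category.comp_id (adj.unit.app M).hom).symm
      rw [← Category.assoc, ht, hs]
    exact congrArg InducedCategory.Hom.hom this
  have hb : Function.Bijective (comp s v) := by
    refine Function.bijective_iff_has_inverse.2 ⟨comp t.hom v, fun x => ?_, fun x => ?_⟩
    · exact congrArg (fun f => comp f v x) hst
    · exact congrArg (fun f => comp f v x) hts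
  have : (comp (adj.unit.app M).hom v : _ → _) = comp s v ∘ comp r v := by
    rw [← hs]; rfl
  rw [this]
  exact hb.comp (hr.app_bijective v hv)

/-- `0 → A → B → C → 0` is short exact. -/
def ShortExactMaps {A B C : Type u} [AddCommGroup A] [Module k A] [AddCommGroup B] [Module k B]
    [AddCommGroup C] [Module k C] (f : A →ₗ[k] B) (g : B →ₗ[k] C) : Prop :=
  Function.Injective f ∧ Function.Surjective g ∧ ∀ x, g x = 0 ↔ ∃ y, f y = x

section ShortExactMaps

variable {A B C A' B' C' : Type u} [AddCommGroup A] [Module k A] [AddCommGroup B] [Module k B]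
    [AddCommGroup C] [Module k C] [AddCommGroup A'] [Module k A'] [AddCommGroup B'] [Module k B']
    [AddCommGroup C'] [Module k C'] {f : A →ₗ[k] B} {g : B →ₗ[k] C} {f' : A' →ₗ[k] B'}
    {g' : B' →ₗ[k] C'}

theorem shortExactMaps_iff {α : A →ₗ[k] A'} {β : B →ₗ[k] B'} {γ : C →ₗ[k] C'}
    (hα : Function.Bijective α) (hβ : Function.Bijective β) (hγ : Function.Bijective γ)
    (hf : ∀ x, f' (α x) = β (f x)) (hg : ∀ x, g' (β x) = γ (g x)) :
    ShortExactMaps f g ↔ ShortExactMaps f' g' := by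
  have h1 : Function.Injective f ↔ Function.Injective f' := by
    rw [← Function.Injective.of_comp_iff hβ.1 f, ← Function.Injective.of_comp_iff' f' hα]
    exact iff_of_eq (congrArg _ (funext fun x => (hf x).symm))
  have h2 : Function.Surjective g ↔ Function.Surjective g' := by
    rw [← Function.Surjective.of_comp_iff' hγ g, ← Function.Surjective.of_comp_iff g' hβ.2]
    exact iff_of_eq (congrArg _ (funext fun x => (hg x).symm))
  have h3 : (∀ x, g x = 0 ↔ ∃ y, f y = x) ↔ ∀ x, g' x = 0 ↔ ∃ y, f' y = x := by
    rw [hβ.2.forall]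
    refine forall_congr' fun x => ?_
    rw [hg, map_eq_zero_iff γ hγ.1, hα.2.exists]
    simp only [hf, hβ.1.eq_iff]
  rw [ShortExactMaps, ShortExactMaps, h1, h2, h3]

end ShortExactMaps

theorem shortExactMaps_pi {ι : Type u} {A B C : ι → Type u} [∀ i, AddCommGroup (A i)]
    [∀ i, Module k (A i)] [∀ i, AddCommGroup (B i)] [∀ i, Module k (B i)]
    [∀ i, AddCommGroup (C i)] [∀ i, Module k (C i)] {f : ∀ i, A i →ₗ[k] B i}
    {g : ∀ i, B i →ₗ[k] C i} (h : ∀ i, ShortExactMaps (f i) (g i)) :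
    ShortExactMaps (LinearMap.pi fun i => f i ∘ₗ LinearMap.proj i)
      (LinearMap.pi fun i => g i ∘ₗ LinearMap.proj i) := by
  refine ⟨fun x y hxy => funext fun i => (h i).1 (congrFun hxy i), fun z => ?_, fun x => ?_⟩
  · choose y hy using fun i => (h i).2.1 (z i)
    exact ⟨y, funext hy⟩
  · constructor
    · intro hx
      choose y hy using fun i => ((h i).2.2 (x i)).1 (congrFun hx i)
      exact ⟨y, funext hy⟩
    · rintro ⟨y, rfl⟩
      exact funext fun i => ((h i).2.2 _).2 ⟨y i, rfl⟩

theorem subsingleton_ext1_of_iso {E E' M M' : QRep k V} (e : E ≅ E') (f : M ≅ M')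
    [Subsingleton (Ext1 E M)] : Subsingleton (Ext1 E' M') := by
  refine subsingleton_of_forall_eq 0 fun x => ?_
  have h : (Abelian.Ext.mk₀ e.inv).comp (((Abelian.Ext.mk₀ e.hom).comp x (zero_add 1)).comp
      (Abelian.Ext.mk₀ f.inv) (add_zero 1)) (zero_add 1) = 0 := by
    rw [Subsingleton.elim (((Abelian.Ext.mk₀ e.hom).comp x (zero_add 1)).comp
      (Abelian.Ext.mk₀ f.inv) (add_zero 1)) 0, Abelian.Ext.comp_zero]
  have h' := congrArg (fun y => Abelian.Ext.comp y (Abelian.Ext.mk₀ f.hom) (add_zero 1)) h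
  simpa using h'

theorem Orth.of_iso {E E' M M' : QRep k V} (e : E ≅ E') (f : M ≅ M') (h : Orth E M) :
    Orth E' M' := by
  have := h.1
  have := h.2
  refine ⟨⟨fun a b => ?_⟩, subsingleton_ext1_of_iso e f⟩
  rw [← cancel_epi e.hom, ← cancel_mono f.inv]
  exact Subsingleton.elim _ _

/-- Away from `i` the units identify the fibres with the original ones. At `i`, `starAct` identifies
the fibre with a product of fibres at targets of arrows, all different from `i` since Ext¹(S_i, S_i)
= 0 forbids loops. -/
theorem IsExceptional.isExactFunctor_of_iso [Finite V] [∀ v w : V, Finite (v ⟶ w)] {E : QRep k V}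
    (hE : IsExceptional E) (hfin : IsHomFinite E) {i : V} (e : E ≅ simpleRep k i)
    {π : FGRep k V ⥤ (rightOrth E).FullSubcategory} (adj : π ⊣ rightOrthIncl E) :
    IsExactFunctor π := by
  intro X Y Z f g w hS
  have hloop : IsEmpty (i ⟶ i) := by
    have := hE.ext_self
    exact isEmpty_hom_of_subsingleton_ext1 (k := k) (subsingleton_ext1_of_iso e e)
  have hnat : ∀ {X Y : FGRep k V} (f : X ⟶ Y) (v : V) (x : fib X.obj v),
      comp (π.map f).hom v (comp (adj.unit.app X).hom v x) =
        comp (adj.unit.app Y).hom v (comp f.hom v x) := fun f v x =>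
    congrArg (fun f => comp (InducedCategory.Hom.hom f) v x) (adj.unit_naturality f)
  have h0 : ∀ v : V, ShortExactMaps (comp f.hom v) (comp g.hom v) := fun v => by
    refine ⟨(shortExact_app hS v).1, (shortExact_app hS v).2.1, fun x =>
      ⟨(shortExact_app hS v).2.2 x, ?_⟩⟩
    rintro ⟨y, rfl⟩
    exact congrArg (fun f => comp f v y) w
  have h1 : ∀ v : V, v ≠ i → ShortExactMaps (comp (π.map f).hom v) (comp (π.map g).hom v) := by
    intro v hv
    have hE0 : Subsingleton (fib E v) := by
      have := subsingleton_fib_simpleRep (k := k) hv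
      refine ⟨fun x y => ?_⟩
      have h : ∀ x, comp e.inv v (comp e.hom v x) = x :=
        fun x => congrArg (fun f => comp f v x) e.hom_inv_id
      rw [← h x, ← h y]
      exact congrArg (comp e.inv v) (Subsingleton.elim (α := fib (simpleRep k i) v) _ _)
    have hb := fun M => hE.unit_app_bijective hfin adj M hE0
    exact (shortExactMaps_iff (hb X) (hb Y) (hb Z) (hnat f v) (hnat g v)).1 (h0 v)
  have h2 : ∀ v : V, ShortExactMaps (comp (π.map f).hom v) (comp (π.map g).hom v) := by
    intro v
    by_cases hv : v = i
    · subst hv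
      have hb := fun M : FGRep k V =>
        starAct_bijective_of_orth ((π.obj M).2.2.of_iso e (Iso.refl _))
      refine (shortExactMaps_iff (hb X) (hb Y) (hb Z) (fun x => ?_) (fun x => ?_)).2
        (shortExactMaps_pi fun a : Out v => h1 a.1 ?_)
      · exact funext fun a => comp_act _ a.2 x
      · exact funext fun a => comp_act _ a.2 x
      · rintro h
        obtain ⟨w, a⟩ := a
        dsimp only at h
        subst h
        exact hloop.false a
    · exact h1 v hv
  have hw : (π.map f).hom ≫ (π.map g).hom = 0 :=
    hom_ext_apply fun v x => ((h2 v).2.2 _).2 ⟨x, rfl⟩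
  exact ⟨hw, shortExact_mk hw (fun v => (h2 v).1) (fun v => (h2 v).2.1)
    fun v x => ((h2 v).2.2 x).1⟩

/-! ### Injective representations -/

/-- The morphism `X ⟶ I_j` given by a linear form on `X_j`. -/
def injDesc {X : QRep k V} {j : V} (φ : fib X j →ₗ[k] k) : X ⟶ injRep k j where
  app w := ModuleCat.ofHom (LinearMap.pi fun q : w ⟶ (Paths.of V).obj j => φ ∘ₗ (X.map q).hom)
  naturality v w p := by
    ext x
    exact funext fun q : w ⟶ (Paths.of V).obj j => congrArg φ (map_comp_apply X p q x).symm

/-- The linear form on `X_j` given by a morphism `X ⟶ I_j`. -/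
def injEval {X : QRep k V} {j : V} (f : X ⟶ injRep k j) : fib X j →ₗ[k] k :=
  (LinearMap.proj (R := k) (φ := fun _ : (Paths.of V).obj j ⟶ (Paths.of V).obj j => k) (𝟙 _)) ∘ₗ
    comp f j

theorem injEval_injDesc {X : QRep k V} {j : V} (φ : fib X j →ₗ[k] k) :
    injEval (injDesc φ) = φ := by
  ext x
  exact congrArg φ (map_id_apply X _ x)

theorem injDesc_injEval {X : QRep k V} {j : V} (f : X ⟶ injRep k j) :
    injDesc (injEval f) = f := by
  refine hom_ext_apply fun v x => funext fun q : (Paths.of V).obj v ⟶ (Paths.of V).obj j => ?_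
  refine (congrFun (NatTrans.naturality_apply f q x) (𝟙 _)).trans ?_
  exact congrArg (comp f v x) (Category.comp_id q)

theorem comp_injDesc {X Y : QRep k V} {j : V} (f : X ⟶ Y) (φ : fib Y j →ₗ[k] k) :
    f ≫ injDesc φ = injDesc (φ ∘ₗ comp f j) := by
  refine hom_ext_apply fun v x => funext fun q : (Paths.of V).obj v ⟶ (Paths.of V).obj j => ?_
  exact congrArg φ (NatTrans.naturality_apply f q x).symm

instance injective_injRep (j : V) : Injective (injRep k j) where
  factors {X Y} g f _ := by
    have hf : Function.Injective (comp f j) := (mono_iff_app f).1 inferInstance _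
    obtain ⟨r, hr⟩ := (comp f j).exists_leftInverse_of_injective (LinearMap.ker_eq_bot.2 hf)
    refine ⟨injDesc (injEval g ∘ₗ r), ?_⟩
    rw [comp_injDesc, LinearMap.comp_assoc, hr, LinearMap.comp_id, injDesc_injEval]

/-- The direct product of the `I_w` over the arrows `i ⟶ w`. -/
def costarRep (k : Type u) [Field k] {V : Type u} [Quiver.{u} V] (i : V) : QRep k V where
  obj v := ModuleCat.of k ((Σ a : Out i, (v ⟶ (Paths.of V).obj a.1)) → k)
  map p := ModuleCat.ofHom (LinearMap.funLeft k k fun x => ⟨x.1, p ≫ x.2⟩)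
  map_id v := by
    ext f x
    simp [LinearMap.funLeft]
  map_comp p q := by
    ext f x
    simp [LinearMap.funLeft]

/-- The projections of `costarRep`. -/
def costarπ {i : V} (a : Out i) : costarRep k i ⟶ injRep k a.1 where
  app v := ModuleCat.ofHom (LinearMap.funLeft k k fun q : v ⟶ (Paths.of V).obj a.1 =>
    (⟨a, q⟩ : Σ a : Out i, (v ⟶ (Paths.of V).obj a.1)))
  naturality _ _ _ := rfl

/-- The morphism into `costarRep` with given components. -/
def costarLift {X : QRep k V} {i : V} (f : ∀ a : Out i, X ⟶ injRep k a.1) : X ⟶ costarRep k i where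
  app v := ModuleCat.ofHom
    (LinearMap.pi fun x : Σ a : Out i, (v ⟶ (Paths.of V).obj a.1) =>
      LinearMap.proj (R := k) (φ := fun _ : v ⟶ (Paths.of V).obj x.1.1 => k) x.2 ∘ₗ
        ((f x.1).app v).hom)
  naturality v w p := by
    ext y
    exact funext fun x : Σ a : Out i, (w ⟶ (Paths.of V).obj a.1) =>
      congrFun (NatTrans.naturality_apply (f x.1) p y) x.2

theorem costarLift_π {X : QRep k V} {i : V} (f : ∀ a : Out i, X ⟶ injRep k a.1) (a : Out i) :
    costarLift f ≫ costarπ a = f a := rfl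

theorem costar_hom_ext {X : QRep k V} {i : V} {f g : X ⟶ costarRep k i}
    (h : ∀ a, f ≫ costarπ a = g ≫ costarπ a) : f = g := by
  refine hom_ext_apply fun v x =>
    funext fun y : Σ a : Out i, ((Paths.of V).obj v ⟶ (Paths.of V).obj a.1) => ?_
  exact congrFun (congrArg (fun t => comp t v x) (h y.1)) y.2

instance injective_costarRep (i : V) : Injective (costarRep k i) where
  factors {X Y} g f _ :=
    ⟨costarLift fun a => Injective.factorThru (g ≫ costarπ a) f, costar_hom_ext fun a => by
      rw [Category.assoc, costarLift_π, Injective.comp_factorThru]⟩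

/-- The morphism from the product of the `I_w` to `I_i`. -/
def costarProj (k : Type u) [Field k] {V : Type u} [Quiver.{u} V] (i : V) [Fintype (Out i)] :
    costarRep k i ⟶ injRep k i :=
  injDesc (∑ a : Out i, LinearMap.proj (R := k)
    (φ := fun _ : Σ a : Out i, ((Paths.of V).obj i ⟶ (Paths.of V).obj a.1) => k)
    ⟨a, (Paths.of V).map a.2⟩)

theorem costarProj_apply {i : V} [Fintype (Out i)] {v : V}
    (f : (Σ a : Out i, ((Paths.of V).obj v ⟶ (Paths.of V).obj a.1)) → k)
    (p : (Paths.of V).obj v ⟶ (Paths.of V).obj i) :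
    (show ((Paths.of V).obj v ⟶ (Paths.of V).obj i) → k from comp (costarProj k i) v f) p =
      ∑ a : Out i, f ⟨a, p ≫ (Paths.of V).map a.2⟩ :=
  LinearMap.sum_apply _ _ _

/-- Under the identification of Hom(X, I_j) with the dual of X_j, composing with `costarProj` is the
transpose of `starAct`. -/
theorem comp_costarProj {X : QRep k V} {i : V} [Fintype (Out i)] (f : X ⟶ costarRep k i) :
    f ≫ costarProj k i =
      injDesc ((∑ a : Out i, injEval (f ≫ costarπ a) ∘ₗ
        LinearMap.proj (R := k) (φ := fun a : Out i => fib X a.1) a) ∘ₗ starAct X i) := by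
  rw [costarProj, comp_injDesc]
  congr 1
  refine LinearMap.ext fun x => ?_
  refine (LinearMap.sum_apply _ _ (comp f i x)).trans (Eq.trans ?_
    (LinearMap.sum_apply _ _ (starAct X i x)).symm)
  refine Finset.sum_congr rfl fun a _ => ?_
  refine Eq.trans ?_ (congrFun (NatTrans.naturality_apply (f ≫ costarπ a)
    ((Paths.of V).map a.2) x) (𝟙 _)).symm
  exact congrArg (fun t => (show fib (costarRep k i) i from comp f i x) ⟨a, t⟩)
    (Category.comp_id ((Paths.of V).map a.2)).symm

theorem comp_costarProj_bijective {X : QRep k V} {i : V} [Fintype (Out i)]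
    (hX : Function.Bijective (starAct X i)) :
    Function.Bijective fun f : X ⟶ costarRep k i => f ≫ costarProj k i := by
  classical
  constructor
  · intro f g hfg
    dsimp only at hfg
    rw [comp_costarProj, comp_costarProj] at hfg
    have h1 := congrArg injEval hfg
    rw [injEval_injDesc, injEval_injDesc, LinearMap.cancel_right hX.2] at h1
    refine costar_hom_ext fun a => ?_
    rw [← injDesc_injEval (f ≫ costarπ a), ← injDesc_injEval (g ≫ costarπ a)]
    congr 1
    ext x
    have h2 := LinearMap.congr_fun h1 (Pi.single a x)
    simp only [LinearMap.sum_apply, LinearMap.comp_apply, LinearMap.proj_apply] at h2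
    rw [Finset.sum_eq_single a (fun b _ hb => by rw [Pi.single_eq_of_ne hb, map_zero])
        (fun h => absurd (Finset.mem_univ a) h),
      Finset.sum_eq_single a (fun b _ hb => by rw [Pi.single_eq_of_ne hb, map_zero])
        (fun h => absurd (Finset.mem_univ a) h), Pi.single_eq_same] at h2
    exact h2
  · intro g
    let e := LinearEquiv.ofBijective _ hX
    let L := injEval g ∘ₗ e.symm.toLinearMap
    refine ⟨costarLift fun a =>
      injDesc (L ∘ₗ LinearMap.single k (fun a : Out i => fib X a.1) a), ?_⟩
    dsimp only
    rw [comp_costarProj, ← injDesc_injEval g]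
    congr 1
    simp only [costarLift_π, injEval_injDesc]
    ext x
    have h1 : (∑ a : Out i, (L ∘ₗ LinearMap.single k (fun a : Out i => fib X a.1) a) ∘ₗ
        LinearMap.proj (R := k) (φ := fun a : Out i => fib X a.1) a) = L := by
      ext b y
      simp only [LinearMap.sum_apply, LinearMap.comp_apply, LinearMap.proj_apply]
      rw [← map_sum]
      congr 1
      exact Finset.univ_sum_single _
    rw [h1]
    exact congrArg (injEval g) (e.symm_apply_apply x)

theorem prefixArrow_bijective {i j : V} (h : j ≠ i) :
    Function.Bijective (prefixArrow i ((Paths.of V).obj j)) :=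
  ⟨prefixArrow_injective i _, fun p => (eq_prefixArrow_or p).resolve_right fun h' => h h'.1⟩

/-- A path from `i` to a different vertex is nontrivial, so restricting functions along
`prefixArrow` loses nothing. -/
theorem starAct_injRep_bijective {i j : V} (h : j ≠ i) :
    Function.Bijective (starAct (injRep k j) i) := by
  let e := Equiv.ofBijective _ (prefixArrow_bijective h)
  constructor
  · intro f g hfg
    refine funext fun p : (Paths.of V).obj i ⟶ (Paths.of V).obj j => ?_
    obtain ⟨⟨a, q⟩, rfl⟩ := e.surjective p
    exact congrFun (congrFun hfg a) q
  · intro y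
    refine ⟨fun p : (Paths.of V).obj i ⟶ (Paths.of V).obj j =>
      (show ((Paths.of V).obj (e.symm p).1.1 ⟶ (Paths.of V).obj j) → k from y (e.symm p).1)
        (e.symm p).2, ?_⟩
    refine funext fun a => funext fun q : (Paths.of V).obj a.1 ⟶ (Paths.of V).obj j => ?_
    have := e.symm_apply_apply ⟨a, q⟩
    exact congrArg (fun z : Σ a : Out i, ((Paths.of V).obj a.1 ⟶ (Paths.of V).obj j) =>
      (show ((Paths.of V).obj z.1.1 ⟶ (Paths.of V).obj j) → k from y z.1) z.2) this

theorem starAct_costarRep_bijective {i : V} [IsEmpty (i ⟶ i)] :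
    Function.Bijective (starAct (costarRep k i) i) := by
  have hne : ∀ b : Out i, b.1 ≠ i := by
    rintro ⟨w, b⟩ h
    dsimp only at h
    subst h
    exact isEmptyElim b
  constructor
  · intro f g hfg
    refine funext fun x : Σ b : Out i, ((Paths.of V).obj i ⟶ (Paths.of V).obj b.1) => ?_
    obtain ⟨b, p⟩ := x
    obtain ⟨⟨a, q⟩, rfl⟩ := (prefixArrow_bijective (hne b)).2 p
    exact congrFun (congrFun hfg a)
      (⟨b, q⟩ : Σ b : Out i, ((Paths.of V).obj a.1 ⟶ (Paths.of V).obj b.1))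
  · intro y
    choose z hz using fun b : Out i => (starAct_injRep_bijective (k := k) (hne b)).2
      fun a => comp (costarπ b) a.1 (y a)
    refine ⟨fun x : Σ b : Out i, ((Paths.of V).obj i ⟶ (Paths.of V).obj b.1) => z x.1 x.2, ?_⟩
    refine funext fun a => funext fun x : Σ b : Out i,
      ((Paths.of V).obj a.1 ⟶ (Paths.of V).obj b.1) => ?_
    exact congrFun (congrFun (hz x.1) a) x.2

/-! ### The Auslander-Reiten translate of a simple representation -/

theorem proj_functional_ext {v w : V} {L L' : fib (proj k v) w →ₗ[k] k}
    (h : ∀ p, L (projMk v p) = L' (projMk v p)) : L = L' :=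
  Finsupp.lhom_ext' fun p => LinearMap.ext_ring (h p)

theorem exists_proj_functional {v w : V} (g : ((Paths.of V).obj v ⟶ (Paths.of V).obj w) → k) :
    ∃ L : fib (proj k v) w →ₗ[k] k, ∀ p, L (projMk v p) = g p :=
  ⟨Finsupp.linearCombination k g, fun p => by
    refine (Finsupp.linearCombination_single k (1 : k) p).trans ?_
    exact one_smul k (g p)⟩

theorem projRep_map_projMk {v w x : V} (p : (Paths.of V).obj v ⟶ (Paths.of V).obj w)
    (q : (Paths.of V).obj w ⟶ (Paths.of V).obj x) :
    comp ((projRep k V).map p.op) x (projMk w q) = projMk v (p ≫ q) :=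
  ModuleCat.free_map_apply _ _

section Tau

open Classical in
/-- The embedding of `τ S_i` into the product of the `I_w`. -/
def tauIncl (k : Type u) [Field k] {V : Type u} [Quiver.{u} V] (i : V) :
    tau (simpleRep k i) ⟶ costarRep k i :=
  homMk (M := tau (simpleRep k i)) (N := costarRep k i)
    (fun v =>
      { toFun := fun (φ : Module.Dual k (Ext1 (simpleRep k i) (proj k v))) =>
          fun x : Σ a : Out i, ((Paths.of V).obj v ⟶ (Paths.of V).obj a.1) =>
            φ (starDelta (proj k v) i (Pi.single x.1 (projMk v x.2)))
        map_add' := fun _ _ => rfl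
        map_smul' := fun _ _ => rfl })
    fun v w a φ => by
      refine funext fun x : Σ a : Out i, ((Paths.of V).obj w ⟶ (Paths.of V).obj a.1) => ?_
      refine congrArg (show Module.Dual k (Ext1 (simpleRep k i) (proj k v)) from φ)
        ((ext1Map_starDelta ((projRep k V).map ((Paths.of V).map a).op) i
          (Pi.single x.1 (projMk w x.2))).trans ?_)
      congr 1
      funext b
      change comp ((projRep k V).map ((Paths.of V).map a).op) b.1
          ((Pi.single x.1 (projMk w x.2) : ∀ a : Out i, fib (proj k w) a.1) b) =
        (Pi.single x.1 (projMk v ((Paths.of V).map a ≫ x.2)) : ∀ a : Out i, fib (proj k v) a.1) b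
      by_cases hb : b = x.1
      · subst hb
        rw [Pi.single_eq_same, Pi.single_eq_same]
        exact projRep_map_projMk _ _
      · rw [Pi.single_eq_of_ne hb, Pi.single_eq_of_ne hb]
        exact map_zero _

open Classical in
/-- The function on arrows followed by paths determined by a linear form. -/
def costarOf {i v : V} (L : (∀ a : Out i, fib (proj k v) a.1) →ₗ[k] k) : fib (costarRep k i) v :=
  fun x : Σ a : Out i, ((Paths.of V).obj v ⟶ (Paths.of V).obj a.1) =>
    L (Pi.single x.1 (projMk v x.2))

variable {i : V}

theorem tauIncl_eq_costarOf {v : V} (φ : Module.Dual k (Ext1 (simpleRep k i) (proj k v))) :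
    comp (tauIncl k i) v φ = costarOf (φ ∘ₗ starDelta (proj k v) i) := rfl

/-- A single arrow suffices: appending it to paths is injective. This is where the existence of an
arrow leaving `i` enters the sequence for τS_i. -/
theorem starAct_proj_injective (a : Out i) (v : V) :
    Function.Injective (starAct (proj k v) i) := by
  have h : Function.Injective (act (proj k v) a.2) := by
    refine Finsupp.mapDomain_injective (M := k)
      (f := fun p : (Paths.of V).obj v ⟶ (Paths.of V).obj i => p ≫ (Paths.of V).map a.2) ?_
    exact Quiver.Path.comp_injective_left (V := V) (Quiver.Hom.toPath a.2)
  exact fun x y hxy => h (congrFun hxy a)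

variable [Fintype (Out i)]

theorem costarOf_bijective (v : V) : Function.Bijective
    (costarOf : ((∀ a : Out i, fib (proj k v) a.1) →ₗ[k] k) → fib (costarRep k i) v) := by
  classical
  constructor
  · intro L L' h
    refine LinearMap.pi_ext' fun a => proj_functional_ext fun p => ?_
    have := congrFun h (⟨a, p⟩ : Σ a : Out i, ((Paths.of V).obj v ⟶ (Paths.of V).obj a.1))
    unfold costarOf at this
    convert! this
  · intro f
    choose L hL using fun a : Out i => exists_proj_functional (k := k) (v := v) (w := a.1)
      fun p => (show (Σ a : Out i, ((Paths.of V).obj v ⟶ (Paths.of V).obj a.1)) → k from f) ⟨a, p⟩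
    refine ⟨∑ a, L a ∘ₗ LinearMap.proj a, ?_⟩
    refine funext fun x : Σ a : Out i, ((Paths.of V).obj v ⟶ (Paths.of V).obj a.1) => ?_
    obtain ⟨a, p⟩ := x
    unfold costarOf
    simp only [LinearMap.sum_apply, LinearMap.comp_apply, LinearMap.proj_apply]
    rw [Finset.sum_eq_single a (fun b _ hb => by rw [Pi.single_eq_of_ne hb, map_zero])
        (fun h => absurd (Finset.mem_univ a) h), Pi.single_eq_same]
    exact hL a p

theorem costarProj_costarOf {v : V} (L : (∀ a : Out i, fib (proj k v) a.1) →ₗ[k] k)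
    (p : (Paths.of V).obj v ⟶ (Paths.of V).obj i) :
    (show ((Paths.of V).obj v ⟶ (Paths.of V).obj i) → k from
      comp (costarProj k i) v (costarOf L)) p = L (starAct (proj k v) i (projMk v p)) := by
  classical
  refine (costarProj_apply _ p).trans ?_
  unfold costarOf
  rw [← map_sum]
  congr 1
  have : starAct (proj k v) i (projMk v p) =
      fun a : Out i => (projMk v (p ≫ (Paths.of V).map a.2) : fib (proj k v) a.1) :=
    funext fun a => projMk_map v p _
  rw [this]
  convert! Finset.univ_sum_single _

theorem costarProj_costarOf_eq_zero_iff {v : V} (L : (∀ a : Out i, fib (proj k v) a.1) →ₗ[k] k) :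
    comp (costarProj k i) v (costarOf L) = 0 ↔ L ∘ₗ starAct (proj k v) i = 0 := by
  constructor
  · intro h
    refine proj_functional_ext fun p => ?_
    exact (costarProj_costarOf L p).symm.trans (congrFun h p)
  · intro h
    refine funext fun p : (Paths.of V).obj v ⟶ (Paths.of V).obj i => ?_
    exact (costarProj_costarOf L p).trans (LinearMap.congr_fun h _)

theorem tauIncl_comp_costarProj : tauIncl k i ≫ costarProj k i = 0 := by
  have key : ∀ (v : V) (φ : Module.Dual k (Ext1 (simpleRep k i) (proj k v))),
      comp (costarProj k i) v (comp (tauIncl k i) v φ) = 0 := by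
    intro v φ
    rw [tauIncl_eq_costarOf, costarProj_costarOf_eq_zero_iff]
    refine LinearMap.ext fun x => ?_
    exact (congrArg φ ((starDelta_eq_zero_iff _).2 ⟨x, rfl⟩)).trans (map_zero φ)
  exact hom_ext_apply fun v φ => key v φ

/-- The exact sequence `0 → τ S_i → ∏ I_w → I_i → 0`, if some arrow starts at `i`. -/
theorem tau_shortExact (a : Out i) :
    (ShortComplex.mk _ _ (tauIncl_comp_costarProj (k := k) (i := i))).ShortExact := by
  refine shortExact_mk _ (fun (v : V) => ?_) (fun (v : V) g => ?_) fun (v : V) f hf => ?_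
  · intro φ φ' h
    let ψ : Module.Dual k (Ext1 (simpleRep k i) (proj k v)) := φ
    let ψ' : Module.Dual k (Ext1 (simpleRep k i) (proj k v)) := φ'
    have h1 : ψ ∘ₗ starDelta (proj k v) i = ψ' ∘ₗ starDelta (proj k v) i :=
      (costarOf_bijective v).1 h
    exact (LinearMap.cancel_right (starDelta_surjective (proj k v) i)).1 h1
  · obtain ⟨G, hG⟩ := exists_proj_functional (k := k)
      (show ((Paths.of V).obj v ⟶ (Paths.of V).obj i) → k from g)
    obtain ⟨r, hr⟩ := (starAct (proj k v) i).exists_leftInverse_of_injective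
      (LinearMap.ker_eq_bot.2 (starAct_proj_injective a v))
    refine ⟨costarOf (G ∘ₗ r), funext fun p : (Paths.of V).obj v ⟶ (Paths.of V).obj i => ?_⟩
    refine (costarProj_costarOf _ p).trans (Eq.trans ?_ (hG p))
    exact congrArg G (LinearMap.congr_fun hr _)
  · obtain ⟨L, rfl⟩ := (costarOf_bijective v).2 f
    have hL := (costarProj_costarOf_eq_zero_iff L).1 hf
    -- `L` vanishes on the image of `starAct`, which is the kernel of `starDelta`; it therefore
    -- factors through Ext¹, and any linear section computes the factor.
    obtain ⟨s, hs⟩ := (starDelta (proj k v) i).exists_rightInverse_of_surjective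
      (LinearMap.range_eq_top.2 (starDelta_surjective (proj k v) i))
    refine ⟨(L ∘ₗ s : Module.Dual k (Ext1 (simpleRep k i) (proj k v))), ?_⟩
    refine (tauIncl_eq_costarOf (L ∘ₗ s)).trans (congrArg costarOf ?_)
    ext1 y
    have h0 : starDelta (proj k v) i (s (starDelta (proj k v) i y) - y) = 0 := by
      rw [map_sub, sub_eq_zero]
      exact LinearMap.congr_fun hs _
    obtain ⟨x, hx⟩ := (starDelta_eq_zero_iff _).1 h0
    have h1 : L (s (starDelta (proj k v) i y) - y) = 0 := by
      rw [← hx]; exact LinearMap.congr_fun hL x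
    rw [map_sub, sub_eq_zero] at h1
    exact h1

/-- As `costarRep` is injective, Hom(X, τS_i) and Ext¹(X, τS_i) are the kernel and cokernel of
composition with `costarProj`. -/
theorem orth_tau_iff (a : Out i) {X : QRep k V} : Orth X (tau (simpleRep k i)) ↔
    Function.Bijective fun f : X ⟶ costarRep k i => f ≫ costarProj k i := by
  have hS := tau_shortExact (k := k) a
  have : Mono (tauIncl k i) := hS.mono_f
  constructor
  · rintro ⟨h1, h2⟩
    constructor
    · intro f g hfg
      have h0 : (f - g) ≫ costarProj k i = 0 := by
        rw [Preadditive.sub_comp, sub_eq_zero]; exact hfg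
      have h3 := hS.exact.lift_f (f - g) h0
      rw [Subsingleton.elim (hS.exact.lift (f - g) h0) 0, zero_comp] at h3
      exact sub_eq_zero.1 h3.symm
    · intro g
      obtain ⟨t, ht⟩ := Abelian.Ext.covariant_sequence_exact₃ X hS (Abelian.Ext.mk₀ g) (n₁ := 1)
        rfl (Subsingleton.elim _ _)
      obtain ⟨f, rfl⟩ := (Abelian.Ext.mk₀_bijective _ _).2 t
      rw [Abelian.Ext.mk₀_comp_mk₀] at ht
      exact ⟨f, (Abelian.Ext.mk₀_bijective _ _).1 ht⟩
  · intro h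
    constructor
    · refine subsingleton_of_forall_eq 0 fun t => ?_
      rw [← cancel_mono (tauIncl k i), zero_comp]
      apply h.1
      dsimp only
      rw [Category.assoc, tauIncl_comp_costarProj, comp_zero, zero_comp]
    · refine subsingleton_of_forall_eq 0 fun x => ?_
      obtain ⟨y, rfl⟩ := Abelian.Ext.covariant_sequence_exact₁ X hS x
        (Abelian.Ext.eq_zero_of_injective (n := 0) _) (n₀ := 0) rfl
      obtain ⟨g, rfl⟩ := (Abelian.Ext.mk₀_bijective _ _).2 y
      obtain ⟨f, rfl⟩ := h.2 g
      dsimp only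
      rw [← Abelian.Ext.mk₀_comp_mk₀, Abelian.Ext.comp_assoc_of_second_deg_zero]
      have := hS.comp_extClass
      dsimp only at this
      rw [this, Abelian.Ext.comp_zero]

end Tau

/-! ### The Nakayama functor on a simple projective representation -/

theorem projective_simpleRep_of_isEmpty {i : V} [IsEmpty (Out i)] : Projective (simpleRep k i) := by
  rw [projective_iff_subsingleton_ext_one]
  intro Y
  exact (starDelta_surjective Y i).subsingleton

/-- An arrow i → w would contribute to Ext¹(S_i, S_w), which projectivity makes zero. -/
theorem isEmpty_out_of_projective [Finite V] [∀ v w : V, Finite (v ⟶ w)] {i : V}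
    (h : Projective (simpleRep k i)) : IsEmpty (Out i) := by
  rw [projective_iff_subsingleton_ext_one] at h
  exact ⟨fun a => (isEmpty_hom_of_subsingleton_ext1 (k := k) (h (Y := simpleRep k a.1))).false a.2⟩

section Nakayama

variable {i : V} [IsEmpty (Out i)]

/-- If no arrow starts at `i`, every element at `i` determines a morphism from `S_i`. -/
def simpleDescOfIsEmpty {M : QRep k V} (x : fib M i) : simpleRep k i ⟶ M :=
  simpleDesc x fun w a => isEmptyElim (⟨w, a⟩ : Out i)

/-- Evaluation at the generator of `S_i`. -/
def simpleEval (M : QRep k V) : (simpleRep k i ⟶ M) ≃ₗ[k] fib M i :=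
  LinearEquiv.ofBijective
    { toFun := fun f => comp f i (simpleMk k i)
      map_add' := fun _ _ => rfl
      map_smul' := fun _ _ => rfl }
    ⟨fun _ _ h => simple_hom_ext h, fun x =>
      ⟨simpleDescOfIsEmpty x, simpleDesc_simpleMk x _⟩⟩

theorem simpleEval_apply {M : QRep k V} (f : simpleRep k i ⟶ M) :
    simpleEval M f = comp f i (simpleMk k i) := rfl

theorem simpleEval_symm_comp {M N : QRep k V} (x : fib M i) (f : M ⟶ N) :
    (simpleEval M).symm x ≫ f = (simpleEval N).symm (comp f i x) := by
  rw [LinearEquiv.eq_symm_apply, simpleEval_apply]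
  refine Eq.trans (b := comp f i (simpleEval M ((simpleEval M).symm x))) rfl ?_
  rw [LinearEquiv.apply_symm_apply]

/-- The comparison of `ν S_i` with `I_i` if no arrow starts at `i`. -/
def nakayamaToInj (k : Type u) [Field k] {V : Type u} [Quiver.{u} V] (i : V) [IsEmpty (Out i)] :
    nakayama (simpleRep k i) ⟶ injRep k i :=
  homMk (M := nakayama (simpleRep k i)) (N := injRep k i)
    (fun v =>
      { toFun := fun (φ : Module.Dual k (simpleRep k i ⟶ proj k v)) =>
          fun p : (Paths.of V).obj v ⟶ (Paths.of V).obj i =>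
            φ ((simpleEval (proj k v)).symm (projMk v p))
        map_add' := fun _ _ => rfl
        map_smul' := fun _ _ => rfl })
    fun v w a φ => by
      refine funext fun p : (Paths.of V).obj w ⟶ (Paths.of V).obj i => ?_
      refine congrArg (show Module.Dual k (simpleRep k i ⟶ proj k v) from φ)
        ((simpleEval_symm_comp (projMk w p) ((projRep k V).map ((Paths.of V).map a).op)).trans ?_)
      exact congrArg _ (projRep_map_projMk _ _)

theorem nakayamaToInj_apply {v : V} (φ : Module.Dual k (simpleRep k i ⟶ proj k v))
    (p : (Paths.of V).obj v ⟶ (Paths.of V).obj i) :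
    (show ((Paths.of V).obj v ⟶ (Paths.of V).obj i) → k from comp (nakayamaToInj k i) v φ) p =
      φ ((simpleEval (proj k v)).symm (projMk v p)) := rfl

instance isIso_nakayamaToInj : IsIso (nakayamaToInj k i) := by
  have key : ∀ v : V, Function.Bijective (comp (nakayamaToInj k i) v) := by
    intro v
    constructor
    · intro φ φ' h
      let ψ : Module.Dual k (simpleRep k i ⟶ proj k v) := φ
      let ψ' : Module.Dual k (simpleRep k i ⟶ proj k v) := φ'
      have h1 : ψ ∘ₗ (simpleEval (proj k v)).symm.toLinearMap =
          ψ' ∘ₗ (simpleEval (proj k v)).symm.toLinearMap :=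
        proj_functional_ext fun p => congrFun h p
      exact (LinearMap.cancel_right (simpleEval (proj k v)).symm.surjective).1 h1
    · intro g
      obtain ⟨L, hL⟩ := exists_proj_functional (k := k)
        (show ((Paths.of V).obj v ⟶ (Paths.of V).obj i) → k from g)
      refine ⟨(L ∘ₗ (simpleEval (proj k v)).toLinearMap :
        Module.Dual k (simpleRep k i ⟶ proj k v)), ?_⟩
      refine funext fun p : (Paths.of V).obj v ⟶ (Paths.of V).obj i => ?_
      refine (nakayamaToInj_apply _ p).trans (Eq.trans ?_ (hL p))
      exact congrArg L ((simpleEval (proj k v)).apply_symm_apply _)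
  have : Mono (nakayamaToInj k i) := (mono_iff_app _).2 fun v => (key v).1
  have : Epi (nakayamaToInj k i) := (epi_iff_app _).2 fun v => (key v).2
  exact isIso_of_mono_of_epi _

theorem orth_nakayama_iff {X : QRep k V} :
    Orth X (nakayama (simpleRep k i)) ↔ Subsingleton (X ⟶ injRep k i) := by
  constructor
  · exact fun h => (h.of_iso (Iso.refl X) (asIso (nakayamaToInj k i))).1
  · intro h
    have h' : Orth X (injRep k i) := ⟨h, ⟨fun a b =>
      (Abelian.Ext.eq_zero_of_injective (n := 0) a).trans
        (Abelian.Ext.eq_zero_of_injective (n := 0) b).symm⟩⟩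
    exact h'.of_iso (Iso.refl X) (asIso (nakayamaToInj k i)).symm

end Nakayama

/-! ### Dual projections of injective representations -/

theorem isLeftOrthProj_self {F M : QRep k V} (h : Orth M F) : IsLeftOrthProj F M M (𝟙 M) where
  mem := h
  existsUnique X _ f := ⟨f, Category.comp_id f, fun g hg => by
    rw [← hg]; exact (Category.comp_id g).symm⟩

/-- The test objects are those with no nonzero map to I_i, so 0 is universal over I_i. For j ≠ i no
path leads from `i` to `j`, so I_j vanishes at `i` and is itself such an object. -/
theorem isDualProj_of_projective [Finite V] [∀ v w : V, Finite (v ⟶ w)] {i : V}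
    (h : Projective (simpleRep k i)) :
    IsDualProj (simpleRep k i) (injRep k i) 0 ∧
      ∀ j : V, j ≠ i → IsDualProj (simpleRep k i) (injRep k j) (injRep k j) := by
  have := isEmpty_out_of_projective h
  rw [show @IsDualProj k _ V _ (simpleRep k i) = fun M N => ∃ c : N ⟶ M,
    IsLeftOrthProj (nakayama (simpleRep k i)) M N c by
      unfold IsDualProj dualObject; rw [if_pos h]]
  refine ⟨⟨0, ?_, fun X hX f => ⟨0, ?_, fun g _ => ?_⟩⟩, fun j hj => ⟨_, isLeftOrthProj_self ?_⟩⟩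
  · exact orth_nakayama_iff.2 ⟨fun f g => (isZero_zero _).eq_of_src f g⟩
  · have := orth_nakayama_iff.1 hX
    exact Subsingleton.elim _ _
  · exact (isZero_zero _).eq_of_tgt _ _
  · refine orth_nakayama_iff.2 ⟨fun f g => ?_⟩
    rw [← injDesc_injEval f, ← injDesc_injEval g]
    congr 1
    refine LinearMap.ext fun x => ?_
    have : x = 0 := by
      refine funext fun p : (Paths.of V).obj i ⟶ (Paths.of V).obj j => ?_
      obtain ⟨z, -⟩ := (prefixArrow_bijective hj).2 p
      exact isEmptyElim z.1
    rw [this, map_zero, map_zero]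

/-- The direct sum of the `a_{ij}` copies of `I_j` is the product over the arrows. -/
def biproductIsoCostar (k : Type u) [Field k] {V : Type u} [Quiver.{u} V] [Finite V]
    [∀ v w : V, Finite (v ⟶ w)] (i : V) :
    (⨁ fun j : V => ⨁ fun _ : Fin (arrowCount i j) => injRep k j) ≅ costarRep k i where
  hom := costarLift fun a =>
    biproduct.π (fun j : V => ⨁ fun _ : Fin (arrowCount i j) => injRep k j) a.1 ≫
      biproduct.π (fun _ : Fin (arrowCount i a.1) => injRep k a.1) (Finite.equivFin _ a.2)
  inv := biproduct.lift fun j => biproduct.lift fun t =>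
    costarπ (⟨j, (Finite.equivFin _).symm t⟩ : Out i)
  hom_inv_id := by
    refine biproduct.hom_ext _ _ fun j => biproduct.hom_ext _ _ fun t => ?_
    simp only [Category.assoc, biproduct.lift_π, Category.id_comp, costarLift_π]
    exact congrArg (fun t =>
      biproduct.π (fun j : V => ⨁ fun _ : Fin (arrowCount i j) => injRep k j) j ≫
      biproduct.π (fun _ : Fin (arrowCount i j) => injRep k j) t) (Equiv.apply_symm_apply _ t)
  inv_hom_id := by
    refine costar_hom_ext fun a => ?_
    rw [Category.assoc, costarLift_π, biproduct.lift_π_assoc, Category.id_comp]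
    refine (biproduct.lift_π _ _).trans ?_
    exact @congrArg (i ⟶ a.1) (costarRep k i ⟶ injRep k a.1) _ _
      (fun b => costarπ (⟨a.1, b⟩ : Out i)) (Equiv.symm_apply_apply _ a.2)

/-- The universal property of ∏ I_w → I_i is precisely `orth_tau_iff`; exceptionality, through the
absence of loops, puts the product itself into the left orthogonal category. -/
theorem isDualProj_of_not_projective [Finite V] [∀ v w : V, Finite (v ⟶ w)] {i : V}
    (hE : IsExceptional (simpleRep k i))
    (h : ¬ Projective (simpleRep k i)) :
    IsDualProj (simpleRep k i) (injRep k i)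
        (⨁ fun j : V => ⨁ fun _ : Fin (arrowCount i j) => injRep k j) ∧
      ∀ j : V, j ≠ i → IsDualProj (simpleRep k i) (injRep k j) (injRep k j) := by
  obtain ⟨a⟩ : Nonempty (Out i) := by
    by_contra hne
    have := not_nonempty_iff.1 hne
    exact h projective_simpleRep_of_isEmpty
  have := isEmpty_hom_of_subsingleton_ext1 hE.ext_self
  have : Fintype (Out i) := Fintype.ofFinite _
  rw [show @IsDualProj k _ V _ (simpleRep k i) = fun M N => ∃ c : N ⟶ M,
    IsLeftOrthProj (tau (simpleRep k i)) M N c by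
      unfold IsDualProj dualObject; rw [if_neg h]]
  let e := biproductIsoCostar k i
  refine ⟨⟨e.hom ≫ costarProj k i, ?_, fun X hX f => ?_⟩,
    fun j hj => ⟨_, isLeftOrthProj_self ?_⟩⟩
  · exact ((orth_tau_iff a).2 (comp_costarProj_bijective starAct_costarRep_bijective)).of_iso
      e.symm (Iso.refl _)
  · have hb := (orth_tau_iff a).1 hX
    obtain ⟨g, hg⟩ := hb.2 f
    refine ⟨g ≫ e.inv, ?_, fun g' hg' => ?_⟩
    · dsimp only at hg ⊢
      rw [Category.assoc, Iso.inv_hom_id_assoc, hg]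
    · rw [Iso.eq_comp_inv]
      apply hb.1
      dsimp only at hg ⊢
      rw [hg, Category.assoc, hg']
  · exact (orth_tau_iff a).2 (comp_costarProj_bijective (starAct_injRep_bijective hj))

end

end QuiverProj

/-! ### The main theorem -/

open QuiverProj in
theorem mainTheorem10 {k : Type u} [Field k] {V : Type u} [Quiver.{u} V]
    [Finite V] [∀ v w : V, Finite (v ⟶ w)] :
    (∀ i j : V, Module.Finite k (Ext1 (simpleRep k i) (simpleRep k j)) ∧
      Module.finrank k (Ext1 (simpleRep k i) (simpleRep k j)) = arrowCount i j) ∧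
    (∀ i : V, IsExceptional (simpleRep k i) →
      (¬ Projective (simpleRep k i) →
        IsDualProj (simpleRep k i) (injRep k i)
          (⨁ fun j : V => ⨁ fun _ : Fin (arrowCount i j) => injRep k j) ∧
        ∀ j : V, j ≠ i → IsDualProj (simpleRep k i) (injRep k j) (injRep k j)) ∧
      (Projective (simpleRep k i) →
        IsDualProj (simpleRep k i) (injRep k i) 0 ∧
        ∀ j : V, j ≠ i → IsDualProj (simpleRep k i) (injRep k j) (injRep k j))) ∧
    (∀ i : V, IsExceptional (simpleRep k i) → IsHomFinite (simpleRep k i) →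
      ∀ π : FGRep k V ⥤ (rightOrth (simpleRep k i)).FullSubcategory,
        (π ⊣ rightOrthIncl (simpleRep k i)) → IsExactFunctor π) ∧
    (∀ E : QRep k V, IsExceptional E → IsHomFinite E →
      (rightOrthIncl E).IsRightAdjoint ∧
      ∀ π : FGRep k V ⥤ (rightOrth E).FullSubcategory, (π ⊣ rightOrthIncl E) →
        (IsExactFunctor π ↔ ∃ i : V, Nonempty (E ≅ simpleRep k i))) := by
  refine ⟨finite_finrank_ext1_simpleRep, fun i hE => ⟨isDualProj_of_not_projective hE,
    isDualProj_of_projective⟩, fun i hE hfin π adj =>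
      hE.isExactFunctor_of_iso hfin (Iso.refl _) adj,
    fun E hE hfin => ⟨hE.isRightAdjoint hfin, fun π adj =>
      ⟨hE.exists_iso_simpleRep hfin adj, ?_⟩⟩⟩
  rintro ⟨i, ⟨e⟩⟩
  exact hE.isExactFunctor_of_iso hfin e adj
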